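/- For a scheme $Y$ write $|Y|$ for its set of closed points, and let $Z_0^{\mathrm{eff}}(Y)$ be the free commutative monoid on $|Y|$ (effective $0$-cycles). **Local statement.** Let $X$ be a scheme of finite type over a finite field $\mathbb F_q$. For $x\in|X|$ put $\deg(x)=[\kappa(x):\mathbb F_q]$, and for $\alpha=\sum_{i=1}^r a_ix_i\in Z_0^{\mathrm{eff}}(X)$ with distinct $x_i$ and $a_i\ge 1$ put $$\deg(\alpha)=\sum_i a_i\deg(x_i),\qquad \psi_X(\alpha)=q^{\deg(\alpha)}\prod_{i=1}^r\bigl(1+q^{-\deg(x_i)}\bigr).$$ Let $Z(X,t)=\prod_{x\in|X|}(1-t^{\deg(x)})^{-1}\in\mathbb Q[[t]]$. Then there are only finitely many effective $0$-cycles of each degree, the product defining $Z(X,t)$ converges formally (each coefficient of the finite partial products is eventually constant), $Z(X,0)=1$, and in $\mathbb Q[[t]]$ $$\Psi(X,t):=\sum_{\alpha\in Z_0^{\mathrm{eff}}(X)}\psi_X(\alpha)\,t^{\deg(\alpha)}=\frac{Z(X,t)\,Z(X,qt)}{Z(X,t^2)} .$$ **Global statement.** Let $X$ be an arithmetic scheme,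 i.e. a scheme of finite type over $\operatorname{Spec}\mathbb Z$, and for each prime $p$ let $X_p=X\times_{\operatorname{Spec}\mathbb Z}\operatorname{Spec}\mathbb F_p$. For $Y=X$ and $Y=X\times\mathbb A^1$ let $$\zeta_Y(s)=\prod_{y\in|Y|}\bigl(1-N(y)^{-s}\bigr)^{-1},\quad N(y)=\#\kappa(y),\qquad\text{and let}\qquad \Psi_X(s)=\prod_{p\ \mathrm{prime}}\Psi(X_p,p^{-s}).$$ Then $$\Psi_X(s)=\frac{\zeta_X(s)\,\zeta_{X\times\mathbb A^1}(s)}{\zeta_X(2s)}$$ in both of the following senses. 1. As formal Dirichlet series: the products defining $\Psi_X$, $\zeta_X$ and $\zeta_{X\times\mathbb A^1}$ converge formally, $\zeta_X(2s)$ is invertible in the ring of formal Dirichlet series over $\mathbb Q$, and the identity holds in that ring. 2. As functions of the complex variable $s$: the series $\sum_{y\in|X\times\mathbb A^1|}N(y)^{-\operatorname{Re}(s)}$ converges for all $s$ in some right half-plane; and for every $s\in\mathbb C$ for which it converges, all series $\Psi(X_p,p^{-s})$ converge absolutely, the products over primes and over closed points defining $\Psi_X(s)$, $\zeta_X(s)$,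 $\zeta_X(2s)$ and $\zeta_{X\times\mathbb A^1}(s)$ converge unconditionally, $\zeta_X(2s)\ne 0$, and the identity holds. -/

import Mathlib

open AlgebraicGeometry CategoryTheory Filter

noncomputable section

namespace ArithPsi

/-- The cardinality `N(x)` of the residue field of `X` at the closed point `x`. -/
def pointNorm (X : Scheme.{0}) (x : closedPoints X) : ℕ :=
  Nat.card (X.residueField x.1)

/-- The monoid of effective `0`-cycles of `X`: the free commutative monoid on the closed points. -/
abbrev EffZeroCycle (X : Scheme.{0}) : Type := closedPoints X →₀ ℕ

section OverField

variable {k : Type} [Field k] {X : Scheme.{0}} (f : X ⟶ Spec (.of k))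

/-- The degree `[κ(x) : k]` of a closed point `x` of the `k`-scheme `X`. Here `k` is identified
with the residue field of `Spec k` at its unique point. -/
def pointDegree (x : closedPoints X) : ℕ := f.residueDegree x.1

/-- The degree `∑ aᵢ deg(xᵢ)` of the effective `0`-cycle `∑ aᵢ xᵢ`. -/
def cycleDegree (α : EffZeroCycle X) : ℕ := α.sum fun x a => a * pointDegree f x

/-- `ψ_X(α) = q ^ deg(α) * ∏ᵢ (1 + q ^ (-deg(xᵢ)))` for `α = ∑ aᵢ xᵢ` with distinct `xᵢ` and
`aᵢ ≥ 1`, where `q` is the cardinality of `k`. -/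
def psi (α : EffZeroCycle X) : ℚ :=
  (Nat.card k : ℚ) ^ cycleDegree f α *
    ∏ x ∈ α.support, (1 + (Nat.card k : ℚ) ^ (-(pointDegree f x : ℤ)))

/-- The formal power series `Ψ(X, t) = ∑_α ψ_X(α) t ^ deg(α)`. -/
def psiSeries : PowerSeries ℚ :=
  PowerSeries.mk fun n => ∑ᶠ α ∈ {α : EffZeroCycle X | cycleDegree f α = n}, psi f α

/-- The value `Ψ(X, z) = ∑_α ψ_X(α) z ^ deg(α)` at a complex number `z`. -/
def psiValue (z : ℂ) : ℂ := ∑' α : EffZeroCycle X, (psi f α : ℂ) * z ^ cycleDegree f α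

/-- The factor `1 / (1 - t ^ deg(x))` of the Hasse--Weil zeta function at a closed point `x`. -/
def hasseWeilFactor (x : closedPoints X) : PowerSeries ℚ :=
  (1 - PowerSeries.X ^ pointDegree f x)⁻¹

open scoped PowerSeries.WithPiTopology in
/-- The Hasse--Weil zeta function `Z(X, t) = ∏_x 1 / (1 - t ^ deg(x))`, where `x` runs through the
closed points; the formal product is taken coefficientwise (with discrete coefficients). -/
def hasseWeilZeta : PowerSeries ℚ :=
  letI : TopologicalSpace ℚ := ⊥
  ∏' x : closedPoints X, hasseWeilFactor f x

end OverField

section Global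

/-- The fibre `X_p` of `X → Spec ℤ` over a prime `p`. -/
def primeFibre {X : Scheme.{0}} (f : X ⟶ Spec (.of ℤ)) (p : Nat.Primes) : Scheme.{0} :=
  Limits.pullback f (Spec.map (CommRingCat.ofHom (Int.castRingHom (ZMod p))))

/-- The structure morphism `X_p → Spec 𝔽_p`. -/
def primeFibreMap {X : Scheme.{0}} (f : X ⟶ Spec (.of ℤ)) (p : Nat.Primes) :
    primeFibre f p ⟶ Spec (.of (ZMod p)) :=
  Limits.pullback.snd f (Spec.map (CommRingCat.ofHom (Int.castRingHom (ZMod p))))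

instance (p : Nat.Primes) : Fact (p : ℕ).Prime := ⟨p.2⟩

/-- The affine line `X × 𝔸¹` over `X`. -/
abbrev affineLine (X : Scheme.{0}) : Scheme.{0} := AffineSpace PUnit X

/-- The formal Dirichlet series `1 / (1 - N(x) ^ (-s))`. -/
def zetaFactor (X : Scheme.{0}) (x : closedPoints X) : ArithmeticFunction ℚ :=
  ArithmeticFunction.ofPowerSeries (pointNorm X x) (1 - PowerSeries.X)⁻¹

/-- The zeta function `ζ_X(s) = ∏_x 1 / (1 - N(x) ^ (-s))` as a formal Dirichlet series. -/
def formalZeta (X : Scheme.{0}) : ArithmeticFunction ℚ :=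
  ArithmeticFunction.eulerProduct (zetaFactor X)

/-- The formal Dirichlet series `F(2s) = ∑ aₙ (n ^ 2) ^ (-s)` for `F(s) = ∑ aₙ n ^ (-s)`. -/
def atTwoS (F : ArithmeticFunction ℚ) : ArithmeticFunction ℚ :=
  ⟨fun n => open Classical in if IsSquare n then F n.sqrt else 0, by simp⟩

/-- The formal Dirichlet series `Ψ(X_p, p ^ (-s))`. -/
def psiFactor {X : Scheme.{0}} (f : X ⟶ Spec (.of ℤ)) (p : Nat.Primes) : ArithmeticFunction ℚ :=
  ArithmeticFunction.ofPowerSeries p (psiSeries (primeFibreMap f p))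

/-- `Ψ_X(s) = ∏_p Ψ(X_p, p ^ (-s))` as a formal Dirichlet series. -/
def formalPsi {X : Scheme.{0}} (f : X ⟶ Spec (.of ℤ)) : ArithmeticFunction ℚ :=
  ArithmeticFunction.eulerProduct (psiFactor f)

/-- The zeta function `ζ_X(s) = ∏_x 1 / (1 - N(x) ^ (-s))` of the complex variable `s`. -/
def zeta (X : Scheme.{0}) (s : ℂ) : ℂ :=
  ∏' x : closedPoints X, (1 - (pointNorm X x : ℂ) ^ (-s))⁻¹

/-- The function `Ψ_X(s) = ∏_p Ψ(X_p, p ^ (-s))` of the complex variable `s`. -/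
def globalPsi {X : Scheme.{0}} (f : X ⟶ Spec (.of ℤ)) (s : ℂ) : ℂ :=
  ∏' p : Nat.Primes, psiValue (primeFibreMap f p) ((p : ℂ) ^ (-s))

end Global

end ArithPsi

end

noncomputable section

namespace ArithPsi

/-! The weight `ψ` is multiplicative over the points of a cycle, so `Ψ` is an Euler product over
closed points. With `N` the norm of a point and `T` its local variable, the factor is `1 + ∑_{a ≥ 1}
N^a (1 + N⁻¹) T^a = (1 + T) / (1 - N T) = (1 - T²) / ((1 - T)(1 - N T))`. Multiplying over all
points gives the local identity (`mk_mul_expand_eq`, `hasProd_expand`).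

Two facts about closed points globalise it. A closed point of `X` lies on exactly one fibre `X_p`
and has norm `p ^ deg` (`sigmaPrimeFibreEquiv`). The closed points of `X × 𝔸¹` over `x` are the
monic irreducible polynomials over `κ(x)`; by unique factorization their Euler product is a sum over
monic polynomials, namely `1 / (1 - N(x) u)` (`hasProd_monicIrred`). Hence `ζ_{X × 𝔸¹}` supplies the
factor `1 / (1 - N T)`.

Formally, both sides of the global identity are multiplicative, so it suffices to compare them under
the ring homomorphisms `primePart p`. These send `ζ_X(s)`, `ζ_{X × 𝔸¹}(s)` and `ζ_X(2s)` to `Z(X_p,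
T)`, `Z(X_p, pT)` and `Z(X_p, T²)`.

Analytically, absolute convergence for `X × 𝔸¹` at real part `σ` gives `∑ N(x)^(1 - σ) < ∞`, by
counting rational points on the lines over `x`. It also forces `σ > 1` unless `X` has no closed
point, so the ratios `N(x)^(1 - σ)` are bounded by some `c < 1`. Geometric domination
(`hasProd_tsum_of_bound`) then makes every Euler product involved converge. The half-plane of
convergence comes from a polynomial bound on the number of points of norm `n`. -/

instance isJacobsonRing_int : IsJacobsonRing ℤ := by
  rw [isJacobsonRing_iff_prime_eq]
  intro P hP
  rcases eq_or_ne P ⊥ with rfl | h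
  · rw [eq_bot_iff]
    intro x hx
    -- With `x` itself as multiplier, `x * x + 1` is a unit of `ℤ`, which leaves only `x = 0`.
    have hu := Ideal.mem_jacobson_bot.mp hx x
    rw [Int.isUnit_iff] at hu
    rw [Ideal.mem_bot]
    rcases hu with hu | hu <;> nlinarith
  · have := hP.isMaximal h
    exact Ideal.jacobson_eq_self_of_isMaximal

/-! ### Closed points and residue fields under immersions -/

/-- Surjectivity on stalks passes to residue fields. Preimmersions cover both uses: closed
immersions of fibres and open affine charts. -/
lemma bijective_residueFieldMap_of_isPreimmersion {Z Y : Scheme.{0}} (i : Z ⟶ Y)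
    [IsPreimmersion i] (z : Z) : Function.Bijective (i.residueFieldMap z) := by
  refine ⟨RingHom.injective _, ?_⟩
  intro y
  obtain ⟨t, rfl⟩ := Z.residue_surjective z y
  obtain ⟨u, rfl⟩ := SurjectiveOnStalks.stalkMap_surjective i z t
  refine ⟨Y.residue _ u, ?_⟩
  have := Scheme.residue_residueFieldMap i z
  exact congr($this u)

lemma card_residueField_of_isPreimmersion {Z Y : Scheme.{0}} (i : Z ⟶ Y)
    [IsPreimmersion i] (z : Z) :
    Nat.card (Z.residueField z) = Nat.card (Y.residueField (i z)) :=
  (Nat.card_congr (.ofBijective _ (bijective_residueFieldMap_of_isPreimmersion i z))).symm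

lemma card_residueField_Spec (R : CommRingCat.{0}) (x : Spec R) (h : x.asIdeal.IsMaximal) :
    Nat.card ((Spec R).residueField x) = Nat.card (R ⧸ x.asIdeal) := by
  rw [Nat.card_congr (Scheme.Spec.residueFieldIso R x).commRingCatIsoToRingEquiv.toEquiv]
  exact (Nat.card_congr
    (.ofBijective _ (Ideal.bijective_algebraMap_quotient_residueField x.asIdeal))).symm

/-- The map of closed points induced by a closed immersion. -/
def closedPointsMap {Z Y : Scheme.{0}} (i : Z ⟶ Y) [IsClosedImmersion i] (z : closedPoints Z) :
    closedPoints Y :=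
  ⟨i z.1, by
    have := i.isClosedEmbedding.isClosedMap _ z.2
    rwa [Set.image_singleton] at this⟩

lemma pointNorm_closedPointsMap {Z Y : Scheme.{0}} (i : Z ⟶ Y) [IsClosedImmersion i]
    (z : closedPoints Z) : pointNorm Y (closedPointsMap i z) = pointNorm Z z :=
  (card_residueField_of_isPreimmersion i z.1).symm

/-- Closed immersions with disjoint ranges covering all closed points decompose the set of closed
points. -/
def sigmaClosedPointsEquiv {Y : Scheme.{0}} {ι : Type} (Z : ι → Scheme.{0})
    (i : ∀ a, Z a ⟶ Y) [∀ a, IsClosedImmersion (i a)]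
    (hdisj : ∀ a b (z : closedPoints (Z a)) (w : closedPoints (Z b)), i a z.1 = i b w.1 → a = b)
    (hcov : ∀ y : closedPoints Y, ∃ a, y.1 ∈ Set.range (i a)) :
    (Σ a, closedPoints (Z a)) ≃ closedPoints Y :=
  .ofBijective (fun z => closedPointsMap (i z.1) z.2) <| by
    refine ⟨?_, ?_⟩
    · rintro ⟨a, z⟩ ⟨b, w⟩ h
      have h' : i a z.1 = i b w.1 := congrArg Subtype.val h
      obtain rfl := hdisj a b z w h'
      have := (i a).isClosedEmbedding.injective h'
      rw [Subtype.ext this]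
    · rintro y
      obtain ⟨a, z, hz⟩ := hcov y
      refine ⟨⟨a, ⟨z, ?_⟩⟩, Subtype.ext hz⟩
      rw [← (i a).isClosedEmbedding.preimage_closedPoints, Set.mem_preimage, hz]
      exact y.2

/-! ### Finiteness of residue fields at closed points -/

section FiniteResidueField

/-- In characteristic zero `ℤ → K` would be injective and integral, making `ℤ` a field. So `K` is
finite over some `ZMod p` with `p ≠ 0`. -/
lemma finite_of_field_of_finite_int (K : Type) [Field K] (φ : ℤ →+* K) (hφ : φ.Finite) :
    Finite K := by
  have : Module.Finite ℤ K :=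
    RingHom.finite_algebraMap.mp (Subsingleton.elim φ (algebraMap ℤ K) ▸ hφ)
  obtain ⟨p, hp⟩ := CharP.exists K
  rcases eq_or_ne p 0 with rfl | h0
  · have : CharZero K := CharP.charP_to_charZero K
    have hinj : Function.Injective (algebraMap ℤ K) := by
      rw [Subsingleton.elim (algebraMap ℤ K) (Int.castRingHom K)]
      exact Int.cast_injective
    exact absurd ((Algebra.IsIntegral.isField_iff_isField hinj).mpr (Field.toIsField K))
      Int.not_isField
  · have : NeZero p := ⟨h0⟩
    let := ZMod.algebra K p
    have : IsScalarTower ℤ (ZMod p) K := .of_algebraMap_eq' (Subsingleton.elim _ _)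
    have : Module.Finite (ZMod p) K := Module.Finite.of_restrictScalars_finite ℤ (ZMod p) K
    exact Module.finite_of_finite (ZMod p)

/-- The Nullstellensatz: a closed point is a closed immersion of the spectrum of a field, and such a
spectrum, if locally of finite type over a Jacobson base, is finite over it. -/
lemma finite_fromSpecResidueField_comp {X Y : Scheme.{0}} (f : X ⟶ Y) [JacobsonSpace Y]
    [LocallyOfFiniteType f] (x : closedPoints X) :
    IsFinite (X.fromSpecResidueField x.1 ≫ f) := by
  have := isClosed_singleton_iff_isClosedImmersion.mp x.2
  exact (isFinite_iff_locallyOfFiniteType_of_jacobsonSpace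
    (f := X.fromSpecResidueField x.1 ≫ f)).mpr inferInstance

lemma finite_residueField_int {X : Scheme.{0}} (f : X ⟶ Spec (.of ℤ)) [LocallyOfFiniteType f]
    (x : closedPoints X) : Finite (X.residueField x.1) := by
  have h := finite_fromSpecResidueField_comp f x
  obtain ⟨φ, hφ⟩ := Spec.map_surjective (X.fromSpecResidueField x.1 ≫ f)
  rw [← hφ, IsFinite.SpecMap_iff] at h
  exact finite_of_field_of_finite_int _ φ.hom h

variable {k : Type} [Field k]

lemma card_residueField_Spec_field (x : Spec (.of k)) :
    Nat.card ((Spec (.of k)).residueField x) = Nat.card k := by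
  have hx : x.asIdeal = ⊥ := (eq_bot_or_eq_top _).resolve_right x.2.ne_top
  have hm : x.asIdeal.IsMaximal := hx ▸ Ideal.bot_isMaximal
  rw [card_residueField_Spec _ x hm, hx]
  exact Nat.card_congr (RingEquiv.quotientBot k).toEquiv

lemma residueDegree_spec [Finite k] {X : Scheme.{0}} (f : X ⟶ Spec (.of k))
    [LocallyOfFiniteType f] (x : closedPoints X) :
    Finite (X.residueField x.1) ∧ 0 < pointDegree f x ∧
      pointNorm X x = Nat.card k ^ pointDegree f x := by
  have h := finite_fromSpecResidueField_comp f x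
  obtain ⟨φ, hφ⟩ := Spec.map_surjective (X.fromSpecResidueField x.1 ≫ f)
  rw [← hφ, IsFinite.SpecMap_iff] at h
  have hfin : Finite (X.residueField x.1) := by
    let : Algebra k (X.residueField x.1) := φ.hom.toAlgebra
    have : Module.Finite k (X.residueField x.1) := h
    exact Module.finite_of_finite k
  let := (f.residueFieldMap x.1).hom.toAlgebra
  have hc := Module.natCard_eq_pow_finrank (K := (Spec (.of k)).residueField (f x.1))
    (V := X.residueField x.1)
  rw [card_residueField_Spec_field] at hc
  refine ⟨hfin, ?_, hc⟩
  exact Module.finrank_pos (R := (Spec (.of k)).residueField (f x.1))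
    (M := X.residueField x.1)

end FiniteResidueField

/-! ### Polynomial bound on the number of points of given norm -/

/-- Fields with `n` elements are all isomorphic to one field `K`, so the primes in question are
kernels of homomorphisms `R → K`, which are determined by the images of `r` generators. The
condition `n ≠ 0` excludes infinite residue fields, whose `Nat.card` is `0`. -/
lemma exists_card_primeSpectrum_le (R : Type) [CommRing R] [Algebra.FiniteType ℤ R] :
    ∃ r : ℕ, ∀ n : ℕ, n ≠ 0 →
      {z : PrimeSpectrum R | Nat.card z.asIdeal.ResidueField = n}.Finite ∧
      {z : PrimeSpectrum R | Nat.card z.asIdeal.ResidueField = n}.ncard ≤ n ^ r := by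
  obtain ⟨s, hs⟩ := (Algebra.FiniteType.out : (⊤ : Subalgebra ℤ R).FG)
  refine ⟨s.card, fun n hn => ?_⟩
  set S := {z : PrimeSpectrum R | Nat.card z.asIdeal.ResidueField = n} with hS
  rcases S.eq_empty_or_nonempty with he | ⟨z₀, hz₀⟩
  · simp [he]
  let K := z₀.asIdeal.ResidueField
  have hK : Nat.card K = n := hz₀
  have : Finite K := Nat.finite_of_card_ne_zero (hK ▸ hn)
  have e : ∀ z : S, Nonempty (z.1.asIdeal.ResidueField ≃+* K) := by
    rintro ⟨z, hz⟩
    have hz' : Nat.card z.asIdeal.ResidueField = n := hz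
    have : Finite z.asIdeal.ResidueField := Nat.finite_of_card_ne_zero (hz' ▸ hn)
    have := Fintype.ofFinite K
    have := Fintype.ofFinite z.asIdeal.ResidueField
    exact ⟨FiniteField.ringEquivOfCardEq (by
      rw [← Nat.card_eq_fintype_card, ← Nat.card_eq_fintype_card, hz', hK])⟩
  replace e := fun z => (e z).some
  let φ : S → (R →ₐ[ℤ] K) := fun z =>
    { (e z).toRingHom.comp (algebraMap R z.1.asIdeal.ResidueField) with
      commutes' := fun r => RingHom.congr_fun (Subsingleton.elim
        (((e z).toRingHom.comp (algebraMap R z.1.asIdeal.ResidueField)).comp (algebraMap ℤ R))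
        (algebraMap ℤ K)) r }
  have hφ : ∀ z x, φ z x = 0 ↔ x ∈ z.1.asIdeal := by
    intro z x
    change e z (algebraMap R z.1.asIdeal.ResidueField x) = 0 ↔ _
    rw [EmbeddingLike.map_eq_zero_iff, Ideal.algebraMap_residueField_eq_zero]
  let F : S → (s → K) := fun z x => φ z x
  have hF : Function.Injective F := by
    intro z w h
    have : φ z = φ w := AlgHom.ext_of_adjoin_eq_top hs fun x hx => congrFun h ⟨x, hx⟩
    refine Subtype.ext (PrimeSpectrum.ext (Ideal.ext fun x => ?_))
    rw [← hφ, ← hφ, this]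
  have hfin : Finite S := Finite.of_injective F hF
  refine ⟨hfin, ?_⟩
  have := Nat.card_le_card_of_injective F hF
  rwa [Nat.card_fun, hK, Nat.card_eq_fintype_card (α := s), Fintype.card_coe] at this

lemma exists_card_pointNorm_le {X : Scheme.{0}} (f : X ⟶ Spec (.of ℤ)) [LocallyOfFiniteType f]
    [QuasiCompact f] :
    ∃ C r : ℕ, ∀ n : ℕ, n ≠ 0 → {x : closedPoints X | pointNorm X x = n}.Finite ∧
      {x : closedPoints X | pointNorm X x = n}.ncard ≤ C * n ^ r := by
  have : CompactSpace X := (quasiCompact_iff_compactSpace (f := f)).mp inferInstance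
  let 𝒰 := X.affineCover.finiteSubcover
  have hft : ∀ j, Algebra.FiniteType ℤ (Γ(𝒰.X j, ⊤)) := by
    intro j
    have h : LocallyOfFiniteType ((𝒰.X j).isoSpec.inv ≫ 𝒰.f j ≫ f) := inferInstance
    obtain ⟨φ, hφ⟩ := Spec.map_surjective ((𝒰.X j).isoSpec.inv ≫ 𝒰.f j ≫ f)
    rw [← hφ, HasRingHomProperty.Spec_iff (P := @LocallyOfFiniteType)] at h
    exact RingHom.finiteType_algebraMap.mp (Subsingleton.elim φ.hom (algebraMap ℤ _) ▸ h)
  choose r hr using fun j => exists_card_primeSpectrum_le (Γ(𝒰.X j, ⊤))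
  have : Fintype 𝒰.I₀ := Fintype.ofFinite _
  let g : ∀ j, Spec Γ(𝒰.X j, ⊤) ⟶ X := fun j => (𝒰.X j).isoSpec.inv ≫ 𝒰.f j
  -- The sum of the exponents of the charts serves as a common upper bound for them.
  refine ⟨Fintype.card 𝒰.I₀, ∑ j, r j, fun n hn => ?_⟩
  let T : ∀ j, Set (PrimeSpectrum Γ(𝒰.X j, ⊤)) := fun j =>
    {z | Nat.card z.asIdeal.ResidueField = n}
  have hsub : Subtype.val '' {x : closedPoints X | pointNorm X x = n} ⊆ ⋃ j, g j '' T j := by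
    rintro _ ⟨x, hx, rfl⟩
    obtain ⟨y, hy⟩ := 𝒰.covers x.1
    obtain ⟨z, rfl⟩ := (𝒰.X (𝒰.idx x.1)).isoSpec.inv.surjective y
    refine Set.mem_iUnion.mpr ⟨𝒰.idx x.1, z, ?_, by simpa [g] using hy⟩
    have hz : g (𝒰.idx x.1) z = x.1 := by simpa [g] using hy
    have h1 := card_residueField_of_isPreimmersion (g (𝒰.idx x.1)) z
    rw [hz] at h1
    change Nat.card _ = n
    rw [← hx, pointNorm, ← h1]
    exact (Nat.card_congr
      (Scheme.Spec.residueFieldIso _ z).commRingCatIsoToRingEquiv.toEquiv).symm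
  have hT : ∀ j, (g j '' T j).Finite := fun j => ((hr j n hn).1).image _
  have hfin : (⋃ j, g j '' T j).Finite := Set.finite_iUnion hT
  refine ⟨Set.Finite.of_finite_image (hfin.subset hsub) Subtype.val_injective.injOn, ?_⟩
  rw [← Set.ncard_image_of_injective _ Subtype.val_injective]
  calc _ ≤ (⋃ j, g j '' T j).ncard := Set.ncard_le_ncard hsub hfin
    _ ≤ ∑ j, (g j '' T j).ncard := Set.ncard_iUnion_le_of_fintype _
    _ ≤ ∑ j : 𝒰.I₀, n ^ ∑ j, r j := by
        refine Finset.sum_le_sum fun j _ => ?_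
        refine ((Set.ncard_image_le (hr j n hn).1).trans (hr j n hn).2).trans ?_
        exact Nat.pow_le_pow_right (Nat.pos_of_ne_zero hn)
          (Finset.single_le_sum (fun _ _ => Nat.zero_le _) (Finset.mem_univ j))
    _ = _ := by simp

/-! ### Fibres over the primes -/

section PrimeFibre

variable {X : Scheme.{0}} (f : X ⟶ Spec (.of ℤ))

/-- The inclusion of the fibre over a prime. -/
def primeFibreι (p : Nat.Primes) : primeFibre f p ⟶ X :=
  Limits.pullback.fst f (Spec.map (CommRingCat.ofHom (Int.castRingHom (ZMod p))))

instance (p : Nat.Primes) : IsClosedImmersion (primeFibreι f p) := by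
  have : IsClosedImmersion (Spec.map (CommRingCat.ofHom (Int.castRingHom (ZMod p)))) :=
    IsClosedImmersion.spec_of_surjective _ (ZMod.intCast_surjective)
  exact inferInstanceAs (IsClosedImmersion (Limits.pullback.fst _ _))

instance [LocallyOfFiniteType f] (p : Nat.Primes) : LocallyOfFiniteType (primeFibreMap f p) :=
  inferInstanceAs (LocallyOfFiniteType (Limits.pullback.snd _ _))

instance [QuasiCompact f] (p : Nat.Primes) : QuasiCompact (primeFibreMap f p) :=
  inferInstanceAs (QuasiCompact (Limits.pullback.snd _ _))

lemma mem_range_primeFibreι (p : Nat.Primes) (x : X) :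
    x ∈ Set.range (primeFibreι f p) ↔ (p : ℤ) ∈ (f x).asIdeal := by
  refine (Set.ext_iff.mp (Scheme.Pullback.range_fst f
    (Spec.map (CommRingCat.ofHom (Int.castRingHom (ZMod p))))) x).trans ?_
  have h := range_comap_of_surjective (ZMod p) (Int.castRingHom (ZMod p))
    ZMod.intCast_surjective
  rw [ZMod.ker_intCastRingHom, PrimeSpectrum.zeroLocus_span] at h
  refine Iff.trans (Set.ext_iff.mp h (f x)) ?_
  exact Set.singleton_subset_iff

lemma exists_prime_natCast_mem {I : Ideal ℤ} (hI : I ≠ ⊥) (hI' : I.IsPrime) :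
    ∃ p : ℕ, p.Prime ∧ (p : ℤ) ∈ I := by
  obtain ⟨g, rfl⟩ := IsPrincipalIdealRing.principal I
  have hg : g ≠ 0 := fun h => hI (by simp [h])
  have hp := Int.prime_iff_natAbs_prime.mp ((Ideal.span_singleton_prime hg).mp hI')
  exact ⟨_, hp, Ideal.mem_span_singleton.mpr (Int.dvd_natAbs.mpr dvd_rfl)⟩

/-- A closed point of an arithmetic scheme lies on exactly one fibre over a prime. -/
def sigmaPrimeFibreEquiv [LocallyOfFiniteType f] :
    (Σ p, closedPoints (primeFibre f p)) ≃ closedPoints X :=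
  sigmaClosedPointsEquiv (primeFibre f) (primeFibreι f)
    (by
      intro p q z w h
      have hp : (p : ℤ) ∈ (f (primeFibreι f p z.1)).asIdeal :=
        (mem_range_primeFibreι f p _).mp ⟨_, rfl⟩
      have hq : (q : ℤ) ∈ (f (primeFibreι f p z.1)).asIdeal :=
        (mem_range_primeFibreι f q _).mp ⟨_, h.symm⟩
      by_contra hne
      have hc : IsCoprime (p : ℤ) (q : ℤ) := Nat.isCoprime_iff_coprime.mpr
        ((Nat.coprime_primes p.2 q.2).mpr fun h => hne (Subtype.ext h))
      obtain ⟨a, b, hab⟩ := hc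
      refine (f (primeFibreι f p z.1)).2.one_notMem ?_
      rw [← hab]
      exact Ideal.add_mem _ (Ideal.mul_mem_left _ _ hp) (Ideal.mul_mem_left _ _ hq))
    (by
      intro x
      -- Since `ℤ` is Jacobson, `x` maps to a closed point, that is, to a maximal and hence nonzero
      -- ideal; the generic point is not hit.
      have hx : IsClosed {f x.1} := f.closePoints_subset_preimage_closedPoints x.2
      have hm : (f x.1).asIdeal.IsMaximal :=
        (PrimeSpectrum.isClosed_singleton_iff_isMaximal _).mp hx
      have hne : (f x.1).asIdeal ≠ ⊥ := Ring.ne_bot_of_isMaximal_of_not_isField hm Int.not_isField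
      obtain ⟨p, hp, hpm⟩ := exists_prime_natCast_mem hne (f x.1).2
      exact ⟨⟨p, hp⟩, (mem_range_primeFibreι f _ _).mpr hpm⟩)

lemma pointNorm_sigmaPrimeFibreEquiv [LocallyOfFiniteType f] (p : Nat.Primes)
    (z : closedPoints (primeFibre f p)) :
    pointNorm X (sigmaPrimeFibreEquiv f ⟨p, z⟩) = p ^ pointDegree (primeFibreMap f p) z := by
  refine (pointNorm_closedPointsMap (primeFibreι f p) z).trans ?_
  rw [(residueDegree_spec (primeFibreMap f p) z).2.2, Nat.card_zmod]

end PrimeFibre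

/-! ### Closed points of `X × 𝔸¹` fibred over those of `X` -/

section AffineLine

variable (X : Scheme.{0})

/-- The inclusion of the fibre of `X × 𝔸¹` over a point `x` of `X`. -/
def affineLineFibreι (x : X) : Spec (.of (Polynomial (X.residueField x))) ⟶ affineLine X :=
  Spec.map (CommRingCat.ofHom
      (MvPolynomial.uniqueAlgEquiv (X.residueField x) PUnit).toRingEquiv.toRingHom) ≫
    (AffineSpace.SpecIso PUnit (X.residueField x)).inv ≫
    AffineSpace.map PUnit (X.fromSpecResidueField x)

lemma isClosedImmersion_affineLineFibreι (x : closedPoints X) :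
    IsClosedImmersion (affineLineFibreι X x.1) := by
  have h1 := isClosed_singleton_iff_isClosedImmersion.mp x.2
  have h2 : IsClosedImmersion (AffineSpace.map PUnit (X.fromSpecResidueField x.1)) :=
    MorphismProperty.of_isPullback (AffineSpace.isPullback_map _).flip h1
  have h3 : IsIso (CommRingCat.ofHom
      (MvPolynomial.uniqueAlgEquiv (X.residueField x.1) PUnit).toRingEquiv.toRingHom) :=
    (MvPolynomial.uniqueAlgEquiv (X.residueField x.1) PUnit).toRingEquiv.toCommRingCatIso.isIso_hom
  unfold affineLineFibreι
  infer_instance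

lemma range_affineLineFibreι (x : X) :
    Set.range (affineLineFibreι X x) = (affineLine X ↘ X) ⁻¹' {x} := by
  have h := AffineSpace.isPullback_map (n := PUnit) (X.fromSpecResidueField x)
  have h3 : IsIso (CommRingCat.ofHom
      (MvPolynomial.uniqueAlgEquiv (X.residueField x) PUnit).toRingEquiv.toRingHom) :=
    (MvPolynomial.uniqueAlgEquiv (X.residueField x) PUnit).toRingEquiv.toCommRingCatIso.isIso_hom
  ext y
  rw [Set.mem_preimage, Set.mem_singleton_iff]
  constructor
  · rintro ⟨z, rfl⟩
    rw [affineLineFibreι, ← Category.assoc, Scheme.Hom.comp_apply, ← Scheme.Hom.comp_apply,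
      AffineSpace.map_over, Scheme.Hom.comp_apply]
    exact Scheme.fromSpecResidueField_apply _ _
  · intro hy
    obtain ⟨w, hw, -⟩ := Scheme.exists_preimage_of_isPullback h y default
      (hy.trans (Scheme.fromSpecResidueField_apply x default).symm)
    obtain ⟨z, hz⟩ := (Spec.map (CommRingCat.ofHom
      (MvPolynomial.uniqueAlgEquiv (X.residueField x) PUnit).toRingEquiv.toRingHom) ≫
      (AffineSpace.SpecIso PUnit (X.residueField x)).inv).surjective w
    refine ⟨z, ?_⟩
    rw [affineLineFibreι, ← Category.assoc, Scheme.Hom.comp_apply, hz]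
    exact hw

/-- The closed points of `X × 𝔸¹` are the closed points of the affine lines over the residue
fields of the closed points of `X`. -/
def sigmaAffineLineEquiv [JacobsonSpace X] :
    (Σ x : closedPoints X, closedPoints (Spec (.of (Polynomial (X.residueField x.1))))) ≃
      closedPoints (affineLine X) :=
  have := isClosedImmersion_affineLineFibreι X
  sigmaClosedPointsEquiv _ (fun x : closedPoints X => affineLineFibreι X x.1)
    (by
      intro x y z w h
      have h1 : affineLineFibreι X x.1 z.1 ∈ (affineLine X ↘ X) ⁻¹' {x.1} :=
        range_affineLineFibreι X x.1 ▸ ⟨_, rfl⟩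
      have h2 : affineLineFibreι X y.1 w.1 ∈ (affineLine X ↘ X) ⁻¹' {y.1} :=
        range_affineLineFibreι X y.1 ▸ ⟨_, rfl⟩
      rw [h] at h1
      exact Subtype.ext (h1.symm.trans h2))
    (by
      intro y
      refine ⟨⟨_, (affineLine X ↘ X).closePoints_subset_preimage_closedPoints y.2⟩, ?_⟩
      rw [range_affineLineFibreι]
      rfl)

end AffineLine

/-! ### Closed points of the affine line over a field -/

section Polynomial

open Polynomial

variable (K : Type) [Field K]

/-- The monic irreducible polynomials in one variable over a field. -/
abbrev MonicIrred : Type := {P : K[X] // P.Monic ∧ Irreducible P}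

/-- The closed points of the affine line over a field are the monic irreducible polynomials. -/
def monicIrredEquiv : MonicIrred K ≃ closedPoints (Spec (.of K[X])) :=
  .ofBijective (fun P => ⟨(⟨Ideal.span {P.1}, (Ideal.span_singleton_prime P.2.2.ne_zero).mpr
      P.2.2.prime⟩ : PrimeSpectrum K[X]), (PrimeSpectrum.isClosed_singleton_iff_isMaximal _).mpr
      (PrincipalIdealRing.isMaximal_of_irreducible P.2.2)⟩) <| by
    refine ⟨?_, ?_⟩
    · intro P Q h
      have h' : Ideal.span {P.1} = Ideal.span {Q.1} :=
        congrArg (fun z => PrimeSpectrum.asIdeal z.1) h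
      rw [Ideal.span_singleton_eq_span_singleton] at h'
      exact Subtype.ext (eq_of_monic_of_associated P.2.1 Q.2.1 h')
    · rintro ⟨z, hz⟩
      have hm : z.asIdeal.IsMaximal := (PrimeSpectrum.isClosed_singleton_iff_isMaximal _).mp hz
      have hne : z.asIdeal ≠ ⊥ := Ring.ne_bot_of_isMaximal_of_not_isField hm (not_isField K)
      obtain ⟨g, hg⟩ := IsPrincipalIdealRing.principal (R := K[X]) z.asIdeal
      have hg0 : g ≠ 0 := fun h => hne (by rw [hg, h]; simp)
      have hspan : Ideal.span {g * C g.leadingCoeff⁻¹} = Ideal.span {g} :=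
        Ideal.span_singleton_mul_right_unit
          (isUnit_C.mpr (inv_ne_zero (leadingCoeff_ne_zero.mpr hg0)).isUnit) _
      refine ⟨⟨g * C g.leadingCoeff⁻¹, monic_mul_leadingCoeff_inv hg0,
        (irreducible_mul_leadingCoeff_inv).mpr ?_⟩, ?_⟩
      · exact ((Ideal.span_singleton_prime hg0).mp (by
          rw [Ideal.span, ← hg]
          exact z.2)).irreducible
      · exact Subtype.ext (PrimeSpectrum.ext (hspan.trans hg.symm))

lemma card_quotient_span_monic {P : K[X]} (hP : P.Monic) :
    Nat.card (K[X] ⧸ Ideal.span {P}) = Nat.card K ^ P.natDegree := by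
  have : Module.Finite K (AdjoinRoot P) := hP.finite_adjoinRoot
  have := Module.natCard_eq_pow_finrank (K := K) (V := AdjoinRoot P)
  rwa [(AdjoinRoot.powerBasis' hP).finrank, AdjoinRoot.powerBasis'_dim] at this

lemma pointNorm_monicIrredEquiv (P : MonicIrred K) :
    pointNorm _ (monicIrredEquiv K P) = Nat.card K ^ P.1.natDegree := by
  refine (card_residueField_Spec (.of K[X]) (monicIrredEquiv K P).1
    ((PrimeSpectrum.isClosed_singleton_iff_isMaximal _).mp (monicIrredEquiv K P).2)).trans ?_
  exact card_quotient_span_monic K P.2.1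

end Polynomial

open scoped PowerSeries.WithPiTopology

/-! ### Formal Euler products as sums over cycles -/

section WeightedCycles

variable {R : Type*} [CommRing R] {ι : Type*}

/-- The finitely supported function `x ↦ α x * d x`. -/
def scaleBy (d : ι → ℕ) (α : ι →₀ ℕ) : ι →₀ ℕ :=
  Finsupp.onFinset α.support (fun x => α x * d x) fun x hx => by
    rw [Finsupp.mem_support_iff]
    exact left_ne_zero_of_mul hx

variable {d : ι → ℕ} (hd : ∀ x, d x ≠ 0)

include hd in
lemma scaleBy_injective : Function.Injective (scaleBy d) := by
  intro α β h
  ext x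
  exact Nat.eq_of_mul_eq_mul_right (Nat.pos_of_ne_zero (hd x)) (DFunLike.congr_fun h x)

variable (hfin : ∀ n, {x | d x = n}.Finite)

include hfin in
lemma finite_setOf_le (n : ℕ) : {x | d x ≤ n}.Finite := by
  have : {x | d x ≤ n} = ⋃ m ∈ Finset.range (n + 1), {x | d x = m} := by
    ext x
    simp
  rw [this]
  exact Set.Finite.biUnion (Finset.finite_toSet _) fun m _ => hfin m

lemma scaleBy_mem_finsuppAntidiag [DecidableEq ι] {n : ℕ} {S : Finset ι}
    (hS : ∀ x, d x ≤ n → x ∈ S)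
    {α : ι →₀ ℕ} (hα : (α.sum fun x a => a * d x) = n) :
    scaleBy d α ∈ S.finsuppAntidiag n := by
  have hsupp : α.support ⊆ S := by
    intro x hx
    refine hS x ?_
    rw [← hα]
    refine le_trans ?_ (Finset.single_le_sum (f := fun x => α x * d x)
      (fun _ _ => Nat.zero_le _) hx)
    exact Nat.le_mul_of_pos_left _ (Nat.pos_of_ne_zero (Finsupp.mem_support_iff.mp hx))
  rw [Finset.mem_finsuppAntidiag]
  constructor
  · rw [← hα]
    refine (Finset.sum_subset hsupp fun x _ hx => ?_).symm
    change α x * d x = 0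
    rw [Finsupp.notMem_support_iff.mp hx, zero_mul]
  · exact Finsupp.support_onFinset_subset.trans hsupp

include hd hfin in
lemma finite_setOf_sum_eq (n : ℕ) :
    {α : ι →₀ ℕ | (α.sum fun x a => a * d x) = n}.Finite := by
  classical
  refine Set.Finite.of_finite_image (f := scaleBy d) ?_ (scaleBy_injective hd).injOn
  refine ((finite_setOf_le hfin n).toFinset.finsuppAntidiag n).finite_toSet.subset ?_
  rintro _ ⟨α, hα, rfl⟩
  exact scaleBy_mem_finsuppAntidiag (fun x hx => by simpa using hx) hα

include hd hfin in
-- The factor at `x` involves only exponents divisible by `d x`. So in the expansion over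
-- distributions `l` of `n` among the points of `S`, only those of the form `scaleBy d α`
-- contribute, and `α` is then a cycle of degree `n`. Points of weight above `n` occur in no such
-- cycle.
lemma coeff_prod_expand (g : ι → ℕ → R) (hg : ∀ x, g x 0 = 1) (n : ℕ) (S : Finset ι)
    (hS : ∀ x, d x ≤ n → x ∈ S) :
    PowerSeries.coeff n (∏ x ∈ S, PowerSeries.expand (d x) (hd x) (PowerSeries.mk (g x))) =
      ∑ᶠ α ∈ {α : ι →₀ ℕ | (α.sum fun x a => a * d x) = n}, ∏ x ∈ α.support, g x (α x) := by
  classical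
  rw [PowerSeries.coeff_prod, finsum_mem_eq_finite_toFinset_sum _ (finite_setOf_sum_eq hd hfin n)]
  symm
  refine Finset.sum_of_injOn (scaleBy d) (scaleBy_injective hd).injOn ?_ ?_ ?_
  · intro α hα
    exact scaleBy_mem_finsuppAntidiag hS (by simpa using hα)
  · intro l hl hl'
    rw [Finset.mem_finsuppAntidiag] at hl
    by_cases hdiv : ∀ x ∈ S, d x ∣ l x
    · refine absurd ?_ hl'
      let α : ι →₀ ℕ := Finsupp.onFinset S (fun x => l x / d x) fun x hx => by
        by_contra hxS
        have : l x = 0 := by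
          by_contra h
          exact hxS (hl.2 (Finsupp.mem_support_iff.mpr h))
        simp [this] at hx
      have hα : scaleBy d α = l := by
        ext x
        change l x / d x * d x = l x
        by_cases hxS : x ∈ S
        · exact Nat.div_mul_cancel (hdiv x hxS)
        · have : l x = 0 := by
            by_contra h
            exact hxS (hl.2 (Finsupp.mem_support_iff.mpr h))
          simp [this]
      refine ⟨α, ?_, hα⟩
      simp only [Set.Finite.coe_toFinset, Set.mem_ofPred_eq]
      rw [← hl.1, ← hα]
      exact Finset.sum_subset Finsupp.support_onFinset_subset fun x _ hx => by
        simp [Finsupp.notMem_support_iff.mp hx]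
    · push Not at hdiv
      obtain ⟨x, hx, hx'⟩ := hdiv
      refine Finset.prod_eq_zero hx ?_
      rw [PowerSeries.coeff_expand, if_neg hx']
  · intro α hα
    have hmem := scaleBy_mem_finsuppAntidiag hS (α := α) (by simpa using hα)
    have hval : ∀ x, PowerSeries.coeff (scaleBy d α x)
        (PowerSeries.expand (d x) (hd x) (PowerSeries.mk (g x))) = g x (α x) := by
      intro x
      change PowerSeries.coeff (α x * d x) _ = _
      rw [PowerSeries.coeff_expand, if_pos (dvd_mul_left _ _),
        Nat.mul_div_cancel _ (Nat.pos_of_ne_zero (hd x)), PowerSeries.coeff_mk]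
    simp_rw [hval]
    refine Finset.prod_subset ?_ fun x _ hx => by rw [Finsupp.notMem_support_iff.mp hx, hg]
    intro x hx
    refine (Finset.mem_finsuppAntidiag.mp hmem).2 (Finsupp.mem_support_iff.mpr ?_)
    exact mul_ne_zero (Finsupp.mem_support_iff.mp hx) (hd x)

lemma hasProd_iff_eventually_coeff [TopologicalSpace R] [DiscreteTopology R]
    {F : ι → PowerSeries R} {G : PowerSeries R} :
    HasProd F G ↔ ∀ n, ∀ᶠ S : Finset ι in atTop,
      PowerSeries.coeff n (∏ x ∈ S, F x) = PowerSeries.coeff n G := by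
  rw [HasProd, SummationFilter.unconditional_filter,
    PowerSeries.WithPiTopology.tendsto_iff_coeff_tendsto]
  simp [nhds_discrete]

include hd hfin in
lemma hasProd_expand [TopologicalSpace R] [DiscreteTopology R] (g : ι → ℕ → R)
    (hg : ∀ x, g x 0 = 1) :
    HasProd (fun x => PowerSeries.expand (d x) (hd x) (PowerSeries.mk (g x)))
      (PowerSeries.mk fun n => ∑ᶠ α ∈ {α : ι →₀ ℕ | (α.sum fun x a => a * d x) = n},
        ∏ x ∈ α.support, g x (α x)) := by
  rw [hasProd_iff_eventually_coeff]
  intro n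
  filter_upwards [eventually_ge_atTop (finite_setOf_le hfin n).toFinset] with S hS
  rw [coeff_prod_expand hd hfin g hg n S fun x hx => hS (by simpa using hx),
    PowerSeries.coeff_mk]
  rfl

end WeightedCycles

/-- Regularity is needed to regroup formal products along fibres with `HasProd.sigma`. -/
lemma regularSpace_powerSeries {R : Type*} [TopologicalSpace R] [DiscreteTopology R] :
    RegularSpace (PowerSeries R) :=
  inferInstanceAs (RegularSpace ((Unit →₀ ℕ) → R))

/-! ### Continuity of substitutions in power series -/

section Continuity

variable {R : Type*} [CommRing R] [TopologicalSpace R] [DiscreteTopology R]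

lemma continuous_of_coeff {φ : PowerSeries R → PowerSeries R}
    (h : ∀ n, ∃ m, ∃ c : R → R, ∀ F, PowerSeries.coeff n (φ F) = c (PowerSeries.coeff m F)) :
    Continuous φ := by
  rw [continuous_iff_continuousAt]
  intro F
  refine (PowerSeries.WithPiTopology.tendsto_iff_coeff_tendsto R _ _ _).mpr fun n => ?_
  obtain ⟨m, c, hc⟩ := h n
  simp_rw [hc]
  exact ((continuous_of_discreteTopology (f := c)).comp
    (PowerSeries.WithPiTopology.continuous_coeff R m)).continuousAt

lemma continuous_expand (d : ℕ) (hd : d ≠ 0) :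
    Continuous (PowerSeries.expand (R := R) d hd) := by
  refine continuous_of_coeff fun n => ⟨n / d, fun a => if d ∣ n then a else 0, fun _ => ?_⟩
  rw [PowerSeries.coeff_expand]

lemma continuous_rescale (q : R) : Continuous (PowerSeries.rescale q) :=
  continuous_of_coeff fun n => ⟨n, fun a => q ^ n * a, fun _ => PowerSeries.coeff_rescale _ _ _⟩

end Continuity

/-! ### The identity between Euler factors -/

section GeometricSeries

variable {R : Type*} [CommRing R]

open PowerSeries

lemma mk_pow_mul_one_sub (c : R) : mk (fun n => c ^ n) * (1 - C c * X) = 1 := by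
  have h := congrArg (rescale c) (mk_one_mul_one_sub_eq_one R)
  rw [map_mul, map_sub, map_one, rescale_X] at h
  refine Eq.trans ?_ h
  congr 1
  ext n
  simp

/-- With `c` the norm and `c'` its inverse, this is `(1 + T)/(1 - cT) · 1/(1 - T²) = 1/(1 - T) ·
1/(1 - cT)`. Each series is characterised by its product with its denominator, and the identity
follows by cross-multiplication. -/
lemma mk_mul_expand_eq {c c' : R} (hc : c * c' = 1) :
    mk (fun a => if a = 0 then 1 else c ^ a * (1 + c')) * expand 2 two_ne_zero (mk 1) =
      mk 1 * mk (fun a => c ^ a) := by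
  have hA : mk (fun a => if a = 0 then 1 else c ^ a * (1 + c')) * (1 - C c * X) = 1 + X := by
    ext n
    rw [mul_sub, mul_one, mul_comm (C c), ← mul_assoc, map_sub, coeff_mul_C]
    rcases n with _ | _ | n
    · simp
    -- The coefficient of `T` is `c (1 + c') - c = c c'`, the only one that needs `c c' = 1`.
    · simp [coeff_X]
      linear_combination hc
    · simp [coeff_succ_mul_X, coeff_X, coeff_one]
      ring
  have hB : expand 2 two_ne_zero (mk 1) * (1 - X ^ 2) = (1 : PowerSeries R) := by
    have h := congrArg (expand 2 two_ne_zero) (mk_one_mul_one_sub_eq_one R)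
    rwa [map_mul, map_sub, map_one, expand_X] at h
  have hC := mk_one_mul_one_sub_eq_one R
  have hD := mk_pow_mul_one_sub c
  set A := mk (fun a => if a = 0 then 1 else c ^ a * (1 + c'))
  set B : PowerSeries R := expand 2 two_ne_zero (mk 1)
  set E : PowerSeries R := mk 1
  set D := mk fun a => c ^ a
  linear_combination (-(A * B * D) * (1 - C c * X)) * hC - (A * B) * hD + E * D * B * (1 - X) * hA
    + E * D * hB

lemma rescale_expand_mk_one (q : R) (d : ℕ) (hd : d ≠ 0) :
    rescale q (expand d hd (mk 1)) = expand d hd (mk fun a => (q ^ d) ^ a) := by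
  ext n
  rw [coeff_rescale, coeff_expand, coeff_expand]
  split_ifs with h
  · obtain ⟨m, rfl⟩ := h
    simp [Nat.mul_div_cancel_left _ (Nat.pos_of_ne_zero hd), pow_mul]
  · simp

lemma expand_comm (d e : ℕ) (hd : d ≠ 0) (he : e ≠ 0) (F : PowerSeries R) :
    expand d hd (expand e he F) = expand e he (expand d hd F) := by
  rw [← expand_mul, ← expand_mul]
  congr 1
  simp [mul_comm]

end GeometricSeries

section Field

variable {K : Type*} [Field K]

open PowerSeries

lemma inv_one_sub_X : (1 - X : PowerSeries K)⁻¹ = mk 1 := by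
  rw [PowerSeries.inv_eq_iff_mul_eq_one (by simp)]
  exact mk_one_mul_one_sub_eq_one K

lemma inv_one_sub_X_pow {d : ℕ} (hd : d ≠ 0) :
    (1 - X ^ d : PowerSeries K)⁻¹ = expand d hd (mk 1) := by
  rw [PowerSeries.inv_eq_iff_mul_eq_one (by simp [hd])]
  have h := congrArg (expand d hd) (mk_one_mul_one_sub_eq_one K)
  rwa [map_mul, map_sub, map_one, expand_X] at h

variable [TopologicalSpace K] [DiscreteTopology K]

/-- The local identity: the generating series of weighted effective cycles in terms of the
zeta function. -/
lemma mk_finsum_mul_expand {ι : Type*} {d : ι → ℕ} (hd : ∀ x, d x ≠ 0)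
    (hfin : ∀ n, {x | d x = n}.Finite) {q : K} (hq : q ≠ 0) {Z : PowerSeries K}
    (hZ : HasProd (fun x => expand (d x) (hd x) (mk 1)) Z) :
    PowerSeries.mk (fun n => ∑ᶠ α ∈ {α : ι →₀ ℕ | (α.sum fun x a => a * d x) = n},
        ∏ x ∈ α.support, (if α x = 0 then 1 else (q ^ d x) ^ α x * (1 + (q ^ d x)⁻¹))) *
      expand 2 two_ne_zero Z = Z * rescale q Z := by
  have h1 := hasProd_expand (R := K) hd hfin
    (fun x a => if a = 0 then 1 else (q ^ d x) ^ a * (1 + (q ^ d x)⁻¹)) (fun x => if_pos rfl)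
  have h2 := hZ.map (expand 2 two_ne_zero) (continuous_expand 2 two_ne_zero)
  have h3 := hZ.map (rescale q) (continuous_rescale q)
  refine (h1.mul h2).unique ?_
  convert! hZ.mul h3 using 2 with x
  change _ * expand 2 _ (expand _ _ _) = _ * rescale q (expand _ _ _)
  rw [expand_comm, rescale_expand_mk_one, ← map_mul, ← map_mul,
    mk_mul_expand_eq (mul_inv_cancel₀ (pow_ne_zero _ hq))]

end Field

/-! ### Unique factorization and the formal zeta function of the affine line -/

section MonicPolynomials

open Polynomial

variable (K : Type) [Field K]

/-- The degree `∑ αₚ deg P` of a formal product of monic irreducible polynomials. -/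
def factorizationDegree (α : MonicIrred K →₀ ℕ) : ℕ := α.sum fun P a => a * P.1.natDegree

lemma prod_monicIrred_spec (α : MonicIrred K →₀ ℕ) :
    (α.prod fun P a => P.1 ^ a).Monic ∧
      (α.prod fun P a => P.1 ^ a).natDegree = factorizationDegree K α := by
  constructor
  · exact monic_prod_of_monic _ _ fun P _ => P.2.1.pow _
  · rw [Finsupp.prod, natDegree_prod_of_monic _ _ fun P _ => P.2.1.pow _]
    exact Finset.sum_congr rfl fun P _ => P.2.1.natDegree_pow _

lemma prod_eq_multiset_prod (α : MonicIrred K →₀ ℕ) :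
    (α.prod fun P a => P.1 ^ a) = ((Finsupp.toMultiset α).map Subtype.val).prod := by
  rw [Finsupp.toMultiset_map, Finsupp.prod_toMultiset]
  exact (Finsupp.prod_mapDomain_index (h := fun (P : K[X]) a => P ^ a) (fun P => pow_zero P)
    fun P => pow_add P).symm

/-- Monic polynomials factor uniquely into monic irreducible polynomials. -/
def factorizationEquiv : (MonicIrred K →₀ ℕ) ≃ {f : K[X] // f.Monic} :=
  .ofBijective (fun α => ⟨α.prod fun P a => P.1 ^ a, (prod_monicIrred_spec K α).1⟩) <| by
    classical
    refine ⟨?_, ?_⟩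
    · intro α β h
      have h' : (α.prod fun P a => P.1 ^ a) = β.prod fun P a => P.1 ^ a := congrArg Subtype.val h
      rw [prod_eq_multiset_prod, prod_eq_multiset_prod] at h'
      have hirr : ∀ γ : MonicIrred K →₀ ℕ, ∀ x ∈ (Finsupp.toMultiset γ).map Subtype.val,
          Irreducible x := by
        intro γ x hx
        obtain ⟨P, -, rfl⟩ := Multiset.mem_map.mp hx
        exact P.2.2
      have hrel := UniqueFactorizationMonoid.factors_unique (hirr α) (hirr β) (h' ▸ .refl _)
      rw [Multiset.rel_map] at hrel
      have hrel' : Multiset.Rel Eq (Finsupp.toMultiset α) (Finsupp.toMultiset β) :=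
        hrel.mono fun P _ Q _ hPQ => Subtype.ext (eq_of_monic_of_associated P.2.1 Q.2.1 hPQ)
      exact Multiset.toFinsupp.symm.injective (Multiset.rel_eq.mp hrel')
    · rintro ⟨f, hf⟩
      let s := UniqueFactorizationMonoid.normalizedFactors f
      have hs : ∀ P ∈ s, P.Monic ∧ Irreducible P := by
        intro P hP
        have hirr := UniqueFactorizationMonoid.irreducible_of_normalized_factor P hP
        refine ⟨?_, hirr⟩
        rw [← UniqueFactorizationMonoid.normalize_normalized_factor P hP]
        exact monic_normalize hirr.ne_zero
      let m : Multiset (MonicIrred K) := s.attach.map fun P => ⟨P.1, hs P.1 P.2⟩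
      refine ⟨Multiset.toFinsupp m, Subtype.ext ?_⟩
      change (Finsupp.prod _ _) = f
      rw [prod_eq_multiset_prod, Multiset.toFinsupp_toMultiset, Multiset.map_map]
      have : (s.attach.map (Subtype.val ∘ fun P => (⟨P.1, hs P.1 P.2⟩ : MonicIrred K))) = s := by
        conv_rhs => rw [← Multiset.attach_map_val s]
        rfl
      rw [this]
      have hmonic : s.prod.Monic := by
        simpa using monic_multiset_prod_of_monic s id fun P hP => (hs P hP).1
      exact eq_of_monic_of_associated hmonic hf
        (UniqueFactorizationMonoid.prod_normalizedFactors hf.ne_zero)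

lemma natDegree_factorizationEquiv (α : MonicIrred K →₀ ℕ) :
    (factorizationEquiv K α).1.natDegree = factorizationDegree K α :=
  (prod_monicIrred_spec K α).2

/-- Formal products of monic irreducible polynomials of degree `n` are monic polynomials of
degree `n`, and these are given by their lower coefficients. -/
def factorizationDegreeEquiv (n : ℕ) : {α // factorizationDegree K α = n} ≃ (Fin n → K) :=
  (((factorizationEquiv K).subtypeEquiv fun α => by
      rw [natDegree_factorizationEquiv]).trans
    (Equiv.subtypeSubtypeEquivSubtypeInter Monic fun f : K[X] => f.natDegree = n)).trans
  ((monicEquivDegreeLT n).trans (degreeLTEquiv K n).toEquiv)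

lemma natCard_factorizationDegree (n : ℕ) :
    Nat.card {α // factorizationDegree K α = n} = Nat.card K ^ n := by
  rw [Nat.card_congr (factorizationDegreeEquiv K n), Nat.card_fun, Nat.card_fin]

lemma finite_setOf_natDegree_eq [Finite K] (n : ℕ) :
    {P : MonicIrred K | P.1.natDegree = n}.Finite := by
  have : Finite {p : K[X] // p.Monic ∧ p.natDegree = n} :=
    Finite.of_equiv _ ((monicEquivDegreeLT n).trans (degreeLTEquiv K n).toEquiv).symm
  exact Finite.of_injective (fun P : {P : MonicIrred K | P.1.natDegree = n} =>
    (⟨P.1.1, P.1.2.1, P.2⟩ : {p : K[X] // p.Monic ∧ p.natDegree = n}))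
    fun P Q h => Subtype.ext (Subtype.ext (Subtype.mk.inj h))

lemma MonicIrred.natDegree_ne_zero (P : MonicIrred K) : P.1.natDegree ≠ 0 :=
  P.2.2.natDegree_pos.ne'

/-- The zeta function of the affine line over a finite field. -/
lemma hasProd_monicIrred [Finite K] {R : Type*} [CommRing R] [TopologicalSpace R]
    [DiscreteTopology R] :
    HasProd (fun P : MonicIrred K => PowerSeries.expand P.1.natDegree
      (MonicIrred.natDegree_ne_zero K P) (PowerSeries.mk 1 : PowerSeries R))
      (PowerSeries.mk fun n => (Nat.card K : R) ^ n) := by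
  convert! hasProd_expand (R := R) (MonicIrred.natDegree_ne_zero K) (finite_setOf_natDegree_eq K)
    (fun _ _ => 1) (fun _ => rfl) using 2
  ext n
  -- All weights are `1`, so the coefficient counts the monic polynomials of degree `n`.
  rw [← Nat.cast_pow, ← natCard_factorizationDegree]
  simp only [Finset.prod_const_one]
  rw [finsum_mem_eq_finite_toFinset_sum _
    (finite_setOf_sum_eq (MonicIrred.natDegree_ne_zero K) (finite_setOf_natDegree_eq K) n),
    Finset.sum_const, nsmul_one, ← Nat.card_eq_card_finite_toFinset]
  rfl

end MonicPolynomials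

/-! ### Prime parts of formal Dirichlet series -/

section PrimePart

variable {R : Type*} [CommRing R]

open ArithmeticFunction

/-- The Euler factor `∑ F(p ^ n) X ^ n` at a prime `p`, as a ring homomorphism. -/
def primePart (p : Nat.Primes) : ArithmeticFunction R →+* PowerSeries R where
  toFun F := PowerSeries.mk fun n => F (p.1 ^ n)
  map_zero' := by ext; simp
  map_add' F G := by ext; simp
  map_one' := by
    ext n
    rw [PowerSeries.coeff_mk, PowerSeries.coeff_one, one_apply]
    simp [p.2.ne_one]
  map_mul' F G := by
    ext n
    rw [PowerSeries.coeff_mk, PowerSeries.coeff_mul, mul_apply]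
    simp_rw [PowerSeries.coeff_mk]
    rw [Nat.sum_divisorsAntidiagonal (fun a b => F a * G b), Nat.sum_divisors_prime_pow p.2,
      Finset.Nat.sum_antidiagonal_eq_sum_range_succ (fun a b => F (p.1 ^ a) * G (p.1 ^ b))]
    refine Finset.sum_congr rfl fun k hk => ?_
    rw [Nat.pow_div (Nat.lt_succ_iff.mp (Finset.mem_range.mp hk)) p.2.pos]

lemma coeff_primePart (p : Nat.Primes) (F : ArithmeticFunction R) (n : ℕ) :
    PowerSeries.coeff n (primePart p F) = F (p.1 ^ n) :=
  PowerSeries.coeff_mk n fun n => F (p.1 ^ n)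

lemma primePart_ofPowerSeries_self (p : Nat.Primes) (F : PowerSeries R) :
    primePart p (ofPowerSeries p.1 F) = F := by
  ext n
  rw [coeff_primePart, ofPowerSeries_apply_pow p.2.one_lt]

lemma primePart_ofPowerSeries_pow (p : Nat.Primes) {d : ℕ} (hd : d ≠ 0) (F : PowerSeries R) :
    primePart p (ofPowerSeries (p.1 ^ d) F) = PowerSeries.expand d hd F := by
  rw [ofPowerSeries_pow _ hd, primePart_ofPowerSeries_self, PowerSeries.expand_apply]

lemma primePart_ofPowerSeries_of_ne {p p' : Nat.Primes} (h : p' ≠ p) {d : ℕ} (hd : d ≠ 0)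
    {F : PowerSeries R} (hF : F.constantCoeff = 1) :
    primePart p (ofPowerSeries (p'.1 ^ d) F) = 1 := by
  ext n
  rw [coeff_primePart, PowerSeries.coeff_one]
  split_ifs with hn
  · rw [hn, pow_zero, ofPowerSeries_apply_one, hF]
  · rw [ofPowerSeries_apply (Nat.one_lt_pow hd p'.2.one_lt), Function.extend_apply']
    · rfl
    · rintro ⟨k, hk⟩
      have hdvd : p.1 ∣ (p'.1 ^ d) ^ k := hk ▸ dvd_pow_self _ hn
      exact h (Subtype.ext ((Nat.prime_dvd_prime_iff_eq p.2 p'.2).mp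
        (p.2.dvd_of_dvd_pow (p.2.dvd_of_dvd_pow hdvd))).symm)

lemma hasProd_primePart [TopologicalSpace R] [DiscreteTopology R] {ι : Type*}
    {F : ι → ArithmeticFunction R} {G : ArithmeticFunction R}
    (h : ∀ n, ∀ᶠ S : Finset ι in atTop, (∏ x ∈ S, F x) n = G n) (p : Nat.Primes) :
    HasProd (fun x => primePart p (F x)) (primePart p G) := by
  rw [hasProd_iff_eventually_coeff]
  intro n
  filter_upwards [h (p.1 ^ n)] with S hS
  rw [← map_prod, coeff_primePart, hS, coeff_primePart]

lemma atTwoS_apply_sq (F : ArithmeticFunction ℚ) (n : ℕ) : atTwoS F (n * n) = F n := by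
  change (if IsSquare (n * n) then F (n * n).sqrt else 0) = F n
  rw [if_pos ⟨n, rfl⟩, Nat.sqrt_eq]

lemma atTwoS_apply_of_not_isSquare (F : ArithmeticFunction ℚ) {n : ℕ} (h : ¬ IsSquare n) :
    atTwoS F n = 0 := by
  change (if IsSquare n then F n.sqrt else 0) = 0
  rw [if_neg h]

lemma primePart_atTwoS (p : Nat.Primes) (F : ArithmeticFunction ℚ) :
    primePart p (atTwoS F) = PowerSeries.expand 2 two_ne_zero (primePart p F) := by
  ext n
  rw [coeff_primePart, PowerSeries.coeff_expand]
  split_ifs with h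
  · obtain ⟨m, rfl⟩ := h
    rw [coeff_primePart, Nat.mul_div_cancel_left _ two_pos, two_mul, pow_add, atTwoS_apply_sq]
  · refine atTwoS_apply_of_not_isSquare F fun hsq => h ?_
    rw [← even_iff_two_dvd]
    obtain ⟨a, ha⟩ := hsq
    obtain ⟨i, -, rfl⟩ := (Nat.dvd_prime_pow p.2).mp (Dvd.intro _ ha.symm)
    rw [← pow_add] at ha
    exact ⟨i, Nat.pow_right_injective p.2.two_le ha⟩

lemma isSquare_of_coprime_mul {m n : ℕ} (h : m.Coprime n) (hs : IsSquare (m * n)) :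
    IsSquare m := by
  obtain ⟨c, hc⟩ := hs
  obtain ⟨d, hd⟩ := exists_eq_pow_of_mul_eq_pow (a := m) (b := n) (c := c) (k := 2)
    (Nat.isUnit_iff.mpr h) (by rw [hc, sq])
  exact ⟨d, by rw [hd, sq]⟩

/-- A product of coprime numbers is a square only if both factors are. -/
lemma isMultiplicative_atTwoS {F : ArithmeticFunction ℚ} (hF : F.IsMultiplicative) :
    (atTwoS F).IsMultiplicative := by
  refine ⟨?_, fun {m n} hmn => ?_⟩
  · rw [← one_mul 1, atTwoS_apply_sq, hF.1]
  · by_cases hm : IsSquare m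
    · by_cases hn : IsSquare n
      · obtain ⟨a, rfl⟩ := hm
        obtain ⟨b, rfl⟩ := hn
        have hab : a.Coprime b :=
          Nat.Coprime.coprime_mul_left (Nat.Coprime.coprime_mul_left_right hmn)
        rw [mul_mul_mul_comm, atTwoS_apply_sq, atTwoS_apply_sq, atTwoS_apply_sq, hF.2 hab]
      · rw [atTwoS_apply_of_not_isSquare F hn, mul_zero, atTwoS_apply_of_not_isSquare]
        exact fun h => hn (isSquare_of_coprime_mul hmn.symm (mul_comm m n ▸ h))
    · rw [atTwoS_apply_of_not_isSquare F hm, zero_mul, atTwoS_apply_of_not_isSquare]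
      exact fun h => hm (isSquare_of_coprime_mul hmn h)

end PrimePart

/-! ### The local statement -/

section Local

/-- Distributing `q ^ deg α` over the support exhibits `ψ` as multiplicative. The branch at `α x =
0` gives the factor the value `1` there, as the Euler product lemmas require. -/
lemma psi_eq_prod {k : Type} [Field k] {X : Scheme.{0}} (f : X ⟶ Spec (.of k))
    (α : EffZeroCycle X) :
    psi f α = ∏ x ∈ α.support, (if α x = 0 then 1 else
      ((Nat.card k : ℚ) ^ pointDegree f x) ^ α x *
        (1 + ((Nat.card k : ℚ) ^ pointDegree f x)⁻¹)) := by
  rw [psi, cycleDegree, Finsupp.sum, ← Finset.prod_pow_eq_pow_sum, ← Finset.prod_mul_distrib]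
  refine Finset.prod_congr rfl fun x hx => ?_
  rw [if_neg (Finsupp.mem_support_iff.mp hx), zpow_neg, zpow_natCast, mul_comm (α x), pow_mul]

variable {k : Type} [Field k] [Finite k] {X : Scheme.{0}} (f : X ⟶ Spec (.of k))
  [LocallyOfFiniteType f]

lemma pointDegree_ne_zero (x : closedPoints X) : pointDegree f x ≠ 0 :=
  (residueDegree_spec f x).2.1.ne'

/-- As `k` is finite, `X` is also of finite type over `ℤ`, and the bound on points of norm `q ^ n`
applies. -/
lemma finite_setOf_pointDegree_eq [QuasiCompact f] (n : ℕ) :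
    {x : closedPoints X | pointDegree f x = n}.Finite := by
  let g : Spec (.of k) ⟶ Spec (.of ℤ) := Spec.map (CommRingCat.ofHom (Int.castRingHom k))
  have hg : LocallyOfFiniteType g := by
    rw [HasRingHomProperty.Spec_iff (P := @LocallyOfFiniteType)]
    exact RingHom.FiniteType.of_finite (RingHom.finite_algebraMap.mpr
      (inferInstanceAs (Module.Finite ℤ k)))
  obtain ⟨C, r, h⟩ := exists_card_pointNorm_le (f ≫ g)
  have hq : Nat.card k ≠ 0 := Nat.card_pos.ne'
  refine (h (Nat.card k ^ n) (pow_ne_zero _ hq)).1.subset fun x hx => ?_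
  change pointNorm X x = _
  rw [(residueDegree_spec f x).2.2]
  exact congrArg _ hx

lemma hasseWeilFactor_eq (x : closedPoints X) :
    hasseWeilFactor f x =
      PowerSeries.expand (pointDegree f x) (pointDegree_ne_zero f x) (PowerSeries.mk 1) :=
  inv_one_sub_X_pow _

variable [QuasiCompact f]

lemma hasProd_hasseWeilFactor :
    letI : TopologicalSpace ℚ := ⊥
    HasProd (hasseWeilFactor f) (hasseWeilZeta f) := by
  let _ : TopologicalSpace ℚ := ⊥
  have : DiscreteTopology ℚ := ⟨rfl⟩
  have h := hasProd_expand (R := ℚ) (pointDegree_ne_zero f) (finite_setOf_pointDegree_eq f)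
    (fun _ => 1) (fun _ => rfl)
  rw [← funext (hasseWeilFactor_eq f)] at h
  exact h.multipliable.hasProd

lemma eventually_coeff_prod_hasseWeilFactor (n : ℕ) :
    ∀ᶠ S : Finset (closedPoints X) in atTop,
      PowerSeries.coeff n (∏ x ∈ S, hasseWeilFactor f x) =
        PowerSeries.coeff n (hasseWeilZeta f) := by
  let _ : TopologicalSpace ℚ := ⊥
  have : DiscreteTopology ℚ := ⟨rfl⟩
  exact hasProd_iff_eventually_coeff.mp (hasProd_hasseWeilFactor f) n

lemma constantCoeff_hasseWeilZeta : PowerSeries.constantCoeff (hasseWeilZeta f) = 1 := by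
  obtain ⟨S, hS⟩ := (eventually_coeff_prod_hasseWeilFactor f 0).exists
  rw [PowerSeries.coeff_zero_eq_constantCoeff_apply,
    PowerSeries.coeff_zero_eq_constantCoeff_apply] at hS
  rw [← hS, map_prod]
  refine Finset.prod_eq_one fun x _ => ?_
  rw [hasseWeilFactor_eq, PowerSeries.constantCoeff_expand]
  simp [← PowerSeries.coeff_zero_eq_constantCoeff_apply]

lemma finite_setOf_cycleDegree_eq (n : ℕ) :
    {α : EffZeroCycle X | cycleDegree f α = n}.Finite :=
  finite_setOf_sum_eq (pointDegree_ne_zero f) (finite_setOf_pointDegree_eq f) n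

lemma psiSeries_mul_expand :
    psiSeries f * PowerSeries.expand 2 two_ne_zero (hasseWeilZeta f) =
      hasseWeilZeta f * PowerSeries.rescale (Nat.card k : ℚ) (hasseWeilZeta f) := by
  let _ : TopologicalSpace ℚ := ⊥
  have : DiscreteTopology ℚ := ⟨rfl⟩
  have hZ := hasProd_hasseWeilFactor f
  rw [funext (hasseWeilFactor_eq f)] at hZ
  have hq : (Nat.card k : ℚ) ≠ 0 := Nat.cast_ne_zero.mpr Nat.card_pos.ne'
  rw [← mk_finsum_mul_expand (pointDegree_ne_zero f) (finite_setOf_pointDegree_eq f) hq hZ]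
  congr 2
  ext n
  rw [psiSeries, PowerSeries.coeff_mk, PowerSeries.coeff_mk]
  simp_rw [← psi_eq_prod]
  rfl

lemma psiSeries_eq :
    psiSeries f = hasseWeilZeta f * PowerSeries.rescale (Nat.card k : ℚ) (hasseWeilZeta f) *
      (PowerSeries.expand 2 two_ne_zero (hasseWeilZeta f))⁻¹ := by
  rw [PowerSeries.eq_mul_inv_iff_mul_eq]
  · exact psiSeries_mul_expand f
  · rw [PowerSeries.constantCoeff_expand, constantCoeff_hasseWeilZeta]
    exact one_ne_zero

lemma constantCoeff_psiSeries : PowerSeries.constantCoeff (psiSeries f) = 1 := by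
  have h := congrArg PowerSeries.constantCoeff (psiSeries_mul_expand f)
  rw [map_mul, map_mul, PowerSeries.constantCoeff_expand, constantCoeff_hasseWeilZeta,
    ← PowerSeries.coeff_zero_eq_constantCoeff_apply (PowerSeries.rescale _ _),
    PowerSeries.coeff_rescale, PowerSeries.coeff_zero_eq_constantCoeff_apply,
    constantCoeff_hasseWeilZeta] at h
  simpa using h

end Local

/-! ### The identity of formal Dirichlet series -/

section Global

variable {X : Scheme.{0}}

lemma jacobsonSpace_of_arithmetic (f : X ⟶ Spec (.of ℤ)) [LocallyOfFiniteType f] :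
    JacobsonSpace X :=
  LocallyOfFiniteType.jacobsonSpace f

lemma exists_pointNorm_eq (f : X ⟶ Spec (.of ℤ)) [LocallyOfFiniteType f] (x : closedPoints X) :
    ∃ (p : Nat.Primes) (d : ℕ), d ≠ 0 ∧ pointNorm X x = p.1 ^ d := by
  obtain ⟨⟨p, z⟩, rfl⟩ := (sigmaPrimeFibreEquiv f).surjective x
  exact ⟨p, _, pointDegree_ne_zero (primeFibreMap f p) z, pointNorm_sigmaPrimeFibreEquiv f p z⟩

lemma one_lt_pointNorm (f : X ⟶ Spec (.of ℤ)) [LocallyOfFiniteType f] (x : closedPoints X) :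
    1 < pointNorm X x := by
  obtain ⟨p, d, hd, h⟩ := exists_pointNorm_eq f x
  exact h ▸ Nat.one_lt_pow hd p.2.one_lt

lemma northcott_pointNorm (f : X ⟶ Spec (.of ℤ)) [LocallyOfFiniteType f] [QuasiCompact f] :
    Northcott (pointNorm X) := by
  obtain ⟨C, r, h⟩ := exists_card_pointNorm_le f
  refine ⟨fun b => ?_⟩
  refine ((Finset.Icc 1 b).finite_toSet.biUnion (t := fun n => {x | pointNorm X x = n})
    fun n hn => (h n ?_).1).subset ?_
  · have := Finset.mem_Icc.mp hn
    lia
  · intro x hx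
    simp only [Set.mem_iUnion]
    exact ⟨_, Finset.mem_coe.mpr (Finset.mem_Icc.mpr ⟨(one_lt_pointNorm f x).le, hx⟩), rfl⟩

lemma northcott_primes : Northcott fun p : Nat.Primes => p.1 := by
  refine ⟨fun b => Set.Finite.of_finite_image (f := Subtype.val) ?_ Subtype.val_injective.injOn⟩
  refine (Set.finite_Iic b).subset ?_
  rintro _ ⟨p, hp, rfl⟩
  exact hp

lemma constantCoeff_inv_one_sub_X :
    PowerSeries.constantCoeff (1 - PowerSeries.X : PowerSeries ℚ)⁻¹ = 1 := by
  simp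

lemma isMultiplicative_formalZeta (f : X ⟶ Spec (.of ℤ)) [LocallyOfFiniteType f] :
    (formalZeta X).IsMultiplicative := by
  refine ArithmeticFunction.isMultiplicative_eulerProduct _ fun x => ?_
  obtain ⟨p, d, hd, h⟩ := exists_pointNorm_eq f x
  refine ArithmeticFunction.isMultiplicative_ofPowerSeries_of_isPrimePow _ ?_ _
    constantCoeff_inv_one_sub_X
  exact h ▸ p.2.isPrimePow.pow hd

lemma eventually_prod_zetaFactor (f : X ⟶ Spec (.of ℤ)) [LocallyOfFiniteType f]
    [QuasiCompact f] (n : ℕ) :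
    ∀ᶠ S : Finset (closedPoints X) in atTop, (∏ x ∈ S, zetaFactor X x) n = formalZeta X n := by
  have := northcott_pointNorm f
  exact ArithmeticFunction.tendsTo_eulerProduct_ofPowerSeries (pointNorm X) _
    (fun _ => constantCoeff_inv_one_sub_X) n

lemma eventually_prod_psiFactor (f : X ⟶ Spec (.of ℤ)) [LocallyOfFiniteType f]
    [QuasiCompact f] (n : ℕ) :
    ∀ᶠ S : Finset Nat.Primes in atTop, (∏ p ∈ S, psiFactor f p) n = formalPsi f n := by
  have := northcott_primes
  exact ArithmeticFunction.tendsTo_eulerProduct_ofPowerSeries (fun p : Nat.Primes => p.1) _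
    (fun p => constantCoeff_psiSeries (primeFibreMap f p)) n

lemma isMultiplicative_formalPsi (f : X ⟶ Spec (.of ℤ)) [LocallyOfFiniteType f]
    [QuasiCompact f] : (formalPsi f).IsMultiplicative :=
  ArithmeticFunction.isMultiplicative_eulerProduct _ fun p =>
    ArithmeticFunction.isMultiplicative_ofPowerSeries_of_isPrimePow _ p.2.isPrimePow _
      (constantCoeff_psiSeries (primeFibreMap f p))

lemma primePart_formalPsi (f : X ⟶ Spec (.of ℤ)) [LocallyOfFiniteType f]
    [QuasiCompact f] (p : Nat.Primes) :
    primePart p (formalPsi f) = psiSeries (primeFibreMap f p) := by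
  let _ : TopologicalSpace ℚ := ⊥
  have : DiscreteTopology ℚ := ⟨rfl⟩
  have h := hasProd_primePart (eventually_prod_psiFactor f) p
  have h1 : primePart p (psiFactor f p) = psiSeries (primeFibreMap f p) :=
    primePart_ofPowerSeries_self p _
  rw [← h1]
  refine h.unique (hasProd_single p fun p' hp' => ?_)
  have := primePart_ofPowerSeries_of_ne hp' one_ne_zero
    (constantCoeff_psiSeries (primeFibreMap f p'))
  rwa [pow_one] at this

/-- A product over the closed points of an arithmetic scheme, whose factors away from the
characteristic `p` are trivial, is a product over the closed points of the fibre at `p`. -/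
lemma hasProd_primeFibre_iff (f : X ⟶ Spec (.of ℤ)) [LocallyOfFiniteType f]
    {M : Type*} [CommMonoid M] [TopologicalSpace M] (p : Nat.Primes)
    {F : closedPoints X → M} {a : M}
    (hF : ∀ (p' : Nat.Primes) (z : closedPoints (primeFibre f p')), p' ≠ p →
      F (sigmaPrimeFibreEquiv f ⟨p', z⟩) = 1) :
    HasProd (fun z => F (sigmaPrimeFibreEquiv f ⟨p, z⟩)) a ↔ HasProd F a := by
  refine Function.Injective.hasProd_iff (g := fun z => sigmaPrimeFibreEquiv f ⟨p, z⟩)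
    ((sigmaPrimeFibreEquiv f).injective.comp sigma_mk_injective) fun x hx => ?_
  obtain ⟨⟨p', z⟩, rfl⟩ := (sigmaPrimeFibreEquiv f).surjective x
  refine hF p' z fun h => hx ?_
  subst h
  exact ⟨z, rfl⟩

lemma primePart_formalZeta (f : X ⟶ Spec (.of ℤ)) [LocallyOfFiniteType f]
    [QuasiCompact f] (p : Nat.Primes) :
    primePart p (formalZeta X) = hasseWeilZeta (primeFibreMap f p) := by
  let _ : TopologicalSpace ℚ := ⊥
  have : DiscreteTopology ℚ := ⟨rfl⟩
  have h := hasProd_primePart (eventually_prod_zetaFactor f) p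
  rw [← hasProd_primeFibre_iff f p] at h
  · refine h.unique ?_
    convert! hasProd_hasseWeilFactor (primeFibreMap f p) using 2 with z
    rw [zetaFactor, pointNorm_sigmaPrimeFibreEquiv,
      primePart_ofPowerSeries_pow p (pointDegree_ne_zero (primeFibreMap f p) z),
      hasseWeilFactor_eq, inv_one_sub_X]
  · intro p' z hp'
    rw [zetaFactor, pointNorm_sigmaPrimeFibreEquiv]
    exact primePart_ofPowerSeries_of_ne hp' (pointDegree_ne_zero (primeFibreMap f p') z)
      constantCoeff_inv_one_sub_X

variable (X) in
/-- The closed points of `X × 𝔸¹` are the monic irreducible polynomials over the residue fields of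
the closed points of `X`. -/
def sigmaMonicIrredEquiv [JacobsonSpace X] :
    (Σ x : closedPoints X, MonicIrred (X.residueField x.1)) ≃ closedPoints (affineLine X) :=
  (Equiv.sigmaCongrRight fun x : closedPoints X => monicIrredEquiv (X.residueField x.1)).trans
    (sigmaAffineLineEquiv X)

lemma pointNorm_sigmaMonicIrredEquiv [JacobsonSpace X] (x : closedPoints X)
    (P : MonicIrred (X.residueField x.1)) :
    pointNorm (affineLine X) (sigmaMonicIrredEquiv X ⟨x, P⟩) =
      pointNorm X x ^ P.1.natDegree := by
  have := isClosedImmersion_affineLineFibreι X x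
  exact (pointNorm_closedPointsMap (affineLineFibreι X x.1) _).trans
    (pointNorm_monicIrredEquiv _ P)

/-- The contribution of the line over `x` is `1 / (1 - N(x) · N(x)^(-s))`. At `p` this is the zeta
function of the affine line over `κ(x)` if `x` has residue characteristic `p`; otherwise all factors
are trivial. -/
lemma hasProd_primePart_zetaFactor_fibre (f : X ⟶ Spec (.of ℤ)) [LocallyOfFiniteType f]
    [JacobsonSpace X] [TopologicalSpace ℚ]
    [DiscreteTopology ℚ] (p : Nat.Primes) (x : closedPoints X) :
    HasProd (fun P => primePart p (zetaFactor (affineLine X) (sigmaMonicIrredEquiv X ⟨x, P⟩)))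
      (primePart p (ArithmeticFunction.ofPowerSeries (pointNorm X x)
        (PowerSeries.mk fun n => (pointNorm X x : ℚ) ^ n))) := by
  have := finite_residueField_int f x
  obtain ⟨p', d, hd, hN⟩ := exists_pointNorm_eq f x
  by_cases hp : p' = p
  · subst hp
    have h := (hasProd_monicIrred (R := ℚ) (X.residueField x.1)).map
      (PowerSeries.expand d hd) (continuous_expand d hd)
    convert! h using 2 with P
    · rw [zetaFactor, pointNorm_sigmaMonicIrredEquiv, hN, ← pow_mul, primePart_ofPowerSeries_pow _
        (mul_ne_zero hd (MonicIrred.natDegree_ne_zero _ P)), inv_one_sub_X]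
      exact PowerSeries.expand_mul _ _ _ _ _
    · rw [hN, primePart_ofPowerSeries_pow _ hd]
      congr 4
      rw [← hN]
      rfl
  · have h1 : ∀ P : MonicIrred (X.residueField x.1), primePart p
        (zetaFactor (affineLine X) (sigmaMonicIrredEquiv X ⟨x, P⟩)) = 1 := by
      intro P
      rw [zetaFactor, pointNorm_sigmaMonicIrredEquiv, hN, ← pow_mul]
      exact primePart_ofPowerSeries_of_ne hp
        (mul_ne_zero hd (MonicIrred.natDegree_ne_zero _ P)) constantCoeff_inv_one_sub_X
    simp_rw [h1]
    rw [hN, primePart_ofPowerSeries_of_ne hp hd (by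
      rw [← PowerSeries.coeff_zero_eq_constantCoeff_apply, PowerSeries.coeff_mk, pow_zero])]
    exact hasProd_one

/-- Grouping the points of `X × 𝔸¹` by their image `x`, a point of degree `d` on `X_p` contributes
`1 / (1 - p^d T^d)`, the Hasse-Weil factor at `pT`. -/
lemma primePart_formalZeta_affineLine (f : X ⟶ Spec (.of ℤ)) [LocallyOfFiniteType f]
    [QuasiCompact f] (p : Nat.Primes) :
    primePart p (formalZeta (affineLine X)) =
      PowerSeries.rescale (p.1 : ℚ) (hasseWeilZeta (primeFibreMap f p)) := by
  let _ : TopologicalSpace ℚ := ⊥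
  have : DiscreteTopology ℚ := ⟨rfl⟩
  have := jacobsonSpace_of_arithmetic f
  have hreg : RegularSpace (PowerSeries ℚ) := regularSpace_powerSeries
  have h := hasProd_primePart (eventually_prod_zetaFactor ((affineLine X ↘ X) ≫ f)) p
  rw [← (sigmaMonicIrredEquiv X).hasProd_iff] at h
  have h' := h.sigma (hasProd_primePart_zetaFactor_fibre f p)
  rw [← hasProd_primeFibre_iff f p] at h'
  · refine h'.unique ?_
    convert! (hasProd_hasseWeilFactor (primeFibreMap f p)).map (PowerSeries.rescale (p.1 : ℚ))
      (continuous_rescale _) using 2 with z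
    have hd := pointDegree_ne_zero (primeFibreMap f p) z
    rw [pointNorm_sigmaPrimeFibreEquiv, primePart_ofPowerSeries_pow p hd]
    change _ = PowerSeries.rescale _ (hasseWeilFactor _ z)
    rw [hasseWeilFactor_eq, rescale_expand_mk_one, Nat.cast_pow]
  · intro p' z hp'
    rw [pointNorm_sigmaPrimeFibreEquiv]
    refine primePart_ofPowerSeries_of_ne hp' (pointDegree_ne_zero (primeFibreMap f p') z) ?_
    rw [← PowerSeries.coeff_zero_eq_constantCoeff_apply, PowerSeries.coeff_mk, pow_zero]

lemma isUnit_atTwoS_formalZeta (f : X ⟶ Spec (.of ℤ)) [LocallyOfFiniteType f]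
    [QuasiCompact f] : IsUnit (atTwoS (formalZeta X)) := by
  rw [ArithmeticFunction.isUnit_iff_isUnit_apply_one,
    (isMultiplicative_atTwoS (isMultiplicative_formalZeta f)).1]
  exact isUnit_one

lemma formalPsi_mul_atTwoS (f : X ⟶ Spec (.of ℤ)) [LocallyOfFiniteType f]
    [QuasiCompact f] :
    formalPsi f * atTwoS (formalZeta X) = formalZeta X * formalZeta (affineLine X) := by
  rw [ArithmeticFunction.IsMultiplicative.eq_iff_eq_on_prime_powers _
    ((isMultiplicative_formalPsi f).mul (isMultiplicative_atTwoS (isMultiplicative_formalZeta f)))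
    _ ((isMultiplicative_formalZeta f).mul
      (isMultiplicative_formalZeta ((affineLine X ↘ X) ≫ f)))]
  intro p n hp
  obtain ⟨p, rfl⟩ : ∃ q : Nat.Primes, q.1 = p := ⟨⟨p, hp⟩, rfl⟩
  have h := psiSeries_mul_expand (primeFibreMap f p)
  rw [← primePart_formalPsi f p, Nat.card_zmod, ← primePart_formalZeta_affineLine f p,
    ← primePart_formalZeta f p, ← primePart_atTwoS, ← map_mul, ← map_mul] at h
  simpa only [coeff_primePart] using congrArg (PowerSeries.coeff n) h

end Global

/-! ### Absolutely convergent Euler products over a free commutative monoid -/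

section EulerProduct

variable {ι : Type*}

/-- Finitely supported functions with support in `insert i S`. -/
def supportInsertEquiv [DecidableEq ι] {i : ι} {S : Finset ι} (hi : i ∉ S) :
    {α : ι →₀ ℕ // α.support ⊆ insert i S} ≃ ℕ × {α : ι →₀ ℕ // α.support ⊆ S} where
  toFun α := (α.1 i, ⟨α.1.erase i, by
    rw [Finsupp.support_erase]
    exact Finset.subset_insert_iff.mp α.2⟩)
  invFun q := ⟨q.2.1.update i q.1, fun j hj => by
    rw [Finset.mem_insert]
    by_cases h : j = i
    · exact .inl h
    · rw [Finsupp.mem_support_iff, Finsupp.update_apply, if_neg h] at hj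
      exact .inr (q.2.2 (Finsupp.mem_support_iff.mpr hj))⟩
  left_inv α := Subtype.ext (by ext j; by_cases h : j = i <;> simp [h])
  right_inv q := by
    obtain ⟨a, β, hβ⟩ := q
    have : β i = 0 := by
      by_contra h
      exact hi (hβ (Finsupp.mem_support_iff.mpr h))
    refine Prod.ext (by simp) (Subtype.ext ?_)
    ext j
    by_cases h : j = i
    · subst h
      simp [this]
    · simp [h]

variable {𝕜 : Type*} [NormedField 𝕜]

lemma prod_support_eq_prod (g : ι → ℕ → 𝕜) (hg : ∀ i, g i 0 = 1) {α : ι →₀ ℕ} {S : Finset ι}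
    (h : α.support ⊆ S) : ∏ j ∈ α.support, g j (α j) = ∏ j ∈ S, g j (α j) :=
  Finset.prod_subset h fun j _ hj => by rw [Finsupp.notMem_support_iff.mp hj, hg]

lemma prod_supportInsertEquiv_symm [DecidableEq ι] (g : ι → ℕ → 𝕜) (hg : ∀ i, g i 0 = 1) {i : ι}
    {S : Finset ι} (hi : i ∉ S) (q : ℕ × {α : ι →₀ ℕ // α.support ⊆ S}) :
    ∏ j ∈ ((supportInsertEquiv hi).symm q).1.support,
        g j (((supportInsertEquiv hi).symm q).1 j) =
      g i q.1 * ∏ j ∈ q.2.1.support, g j (q.2.1 j) := by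
  have hval : ∀ j, ((supportInsertEquiv hi).symm q).1 j = if j = i then q.1 else q.2.1 j :=
    fun j => by
      rw [← Finsupp.update_apply]
      rfl
  rw [prod_support_eq_prod g hg ((supportInsertEquiv hi).symm q).2,
    prod_support_eq_prod g hg q.2.2, Finset.prod_insert hi, hval, if_pos rfl]
  congr 1
  refine Finset.prod_congr rfl fun j hj => ?_
  rw [hval, if_neg (ne_of_mem_of_not_mem hj hi)]

/-- Induction on `S`: splitting off the exponent at the new index turns the sum into a product of
two absolutely convergent series. -/
lemma tsum_support_subset [CompleteSpace 𝕜] (g : ι → ℕ → 𝕜) (hg : ∀ i, g i 0 = 1)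
    (hs : ∀ i, Summable fun a => ‖g i a‖) (S : Finset ι) :
    (Summable fun α : {α : ι →₀ ℕ // α.support ⊆ S} => ‖∏ i ∈ α.1.support, g i (α.1 i)‖) ∧
      ∑' α : {α : ι →₀ ℕ // α.support ⊆ S}, ∏ i ∈ α.1.support, g i (α.1 i) =
        ∏ i ∈ S, ∑' a, g i a := by
  classical
  induction S using Finset.induction_on with
  | empty =>
    have : Unique {α : ι →₀ ℕ // α.support ⊆ ∅} :=
      { default := ⟨0, by simp⟩
        uniq := fun α => Subtype.ext (Finsupp.support_eq_empty.mp (Finset.subset_empty.mp α.2)) }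
    refine ⟨(hasSum_fintype _).summable, ?_⟩
    rw [tsum_fintype, Fintype.sum_unique, Finset.prod_empty]
    exact Finset.prod_eq_one fun i hi => absurd (this.default.2 hi) (Finset.notMem_empty i)
  | insert i S hi ih =>
    constructor
    · rw [← (supportInsertEquiv hi).symm.summable_iff]
      simp only [Function.comp_def, prod_supportInsertEquiv_symm g hg hi]
      exact Summable.mul_norm (f := g i) (g := fun α : {α : ι →₀ ℕ // α.support ⊆ S} =>
        ∏ j ∈ α.1.support, g j (α.1 j)) (hs i) ih.1
    · rw [← (supportInsertEquiv hi).symm.tsum_eq]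
      simp only [prod_supportInsertEquiv_symm g hg hi]
      rw [Finset.prod_insert hi, ← ih.2, tsum_mul_tsum_of_summable_norm (f := g i)
        (g := fun α : {α : ι →₀ ℕ // α.support ⊆ S} => ∏ j ∈ α.1.support, g j (α.1 j)) (hs i) ih.1]

variable {g : ι → ℕ → 𝕜} {u : ι → ℝ} {c : ℝ}

/-- Each local sum of norms is at most `1 + u i / (1 - c) ≤ exp (u i / (1 - c))`. A finite partial
sum involves only finitely many indices, so it is bounded by a finite product of local sums, hence
by `exp (∑ u / (1 - c))`. -/
lemma summable_prod_of_bound (hg : ∀ i, g i 0 = 1) (hu : Summable u) (hu0 : ∀ i, 0 ≤ u i)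
    (hc0 : 0 ≤ c) (hc : c < 1) (hb : ∀ i a, ‖g i (a + 1)‖ ≤ u i * c ^ a) :
    Summable fun α : ι →₀ ℕ => ‖∏ i ∈ α.support, g i (α i)‖ := by
  classical
  have hgeo := summable_geometric_of_lt_one hc0 hc
  have hs1 : ∀ i, Summable fun a => ‖g i (a + 1)‖ := fun i =>
    .of_nonneg_of_le (fun _ => norm_nonneg _) (hb i) (hgeo.mul_left _)
  have hs : ∀ i, Summable fun a => ‖g i a‖ := fun i =>
    (summable_nat_add_iff 1).mp (hs1 i)
  have htsum : ∀ i, ∑' a, ‖g i a‖ ≤ Real.exp (u i * (1 - c)⁻¹) := by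
    intro i
    rw [(hs i).tsum_eq_zero_add, hg, norm_one, add_comm]
    refine le_trans ?_ (Real.add_one_le_exp _)
    gcongr
    calc _ ≤ ∑' a, u i * c ^ a := (hs1 i).tsum_le_tsum (hb i) (hgeo.mul_left _)
      _ = _ := by rw [tsum_mul_left, tsum_geometric_of_lt_one hc0 hc]
  refine summable_of_sum_le (c := Real.exp ((∑' i, u i) * (1 - c)⁻¹)) (fun _ => norm_nonneg _)
    fun F => ?_
  let S : Finset ι := F.biUnion Finsupp.support
  have hF : ∀ α ∈ F, α.support ⊆ S := fun α hα => Finset.subset_biUnion_of_mem _ hα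
  have h := tsum_support_subset (fun i a => ‖g i a‖) (fun i => by rw [hg, norm_one])
    (fun i => by simpa using hs i) S
  simp only [norm_prod, norm_norm] at h ⊢
  calc ∑ α ∈ F, ∏ i ∈ α.support, ‖g i (α i)‖
      = ∑ α ∈ F.attach.map ⟨fun α => (⟨α.1, hF α.1 α.2⟩ : {α : ι →₀ ℕ // α.support ⊆ S}),
          fun α β h => Subtype.ext (congrArg (fun x => x.1) h)⟩,
          ∏ i ∈ α.1.support, ‖g i (α.1 i)‖ := by
        rw [Finset.sum_map]
        exact (Finset.sum_attach F fun α => ∏ i ∈ α.support, ‖g i (α i)‖).symm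
    _ ≤ ∑' α : {α : ι →₀ ℕ // α.support ⊆ S}, ∏ i ∈ α.1.support, ‖g i (α.1 i)‖ :=
        h.1.sum_le_tsum _ fun _ _ => Finset.prod_nonneg fun _ _ => norm_nonneg _
    _ = ∏ i ∈ S, ∑' a, ‖g i a‖ := h.2
    _ ≤ ∏ i ∈ S, Real.exp (u i * (1 - c)⁻¹) :=
        Finset.prod_le_prod (fun _ _ => tsum_nonneg fun _ => norm_nonneg _) fun i _ => htsum i
    _ = Real.exp ((∑ i ∈ S, u i) * (1 - c)⁻¹) := by rw [← Real.exp_sum, Finset.sum_mul]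
    _ ≤ _ := by
        have := inv_nonneg.mpr (sub_nonneg.mpr hc.le)
        gcongr
        exact hu.sum_le_tsum _ fun _ _ => hu0 _

/-- An absolutely convergent Euler product over a free commutative monoid. -/
lemma hasProd_tsum_of_bound [CompleteSpace 𝕜] (hg : ∀ i, g i 0 = 1) (hu : Summable u)
    (hu0 : ∀ i, 0 ≤ u i)
    (hc0 : 0 ≤ c) (hc : c < 1) (hb : ∀ i a, ‖g i (a + 1)‖ ≤ u i * c ^ a) :
    HasProd (fun i => ∑' a, g i a) (∑' α : ι →₀ ℕ, ∏ i ∈ α.support, g i (α i)) := by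
  classical
  have hsum := summable_prod_of_bound hg hu hu0 hc0 hc hb
  have hs : ∀ i, Summable fun a => ‖g i a‖ := fun i =>
    (summable_nat_add_iff 1).mp (.of_nonneg_of_le (fun _ => norm_nonneg _) (hb i)
      ((summable_geometric_of_lt_one hc0 hc).mul_left _))
  -- A partial product is the part of the full sum supported in `S`, so dominated convergence yields
  -- the limit.
  have heq : ∀ S : Finset ι, ∏ i ∈ S, ∑' a, g i a = ∑' α : ι →₀ ℕ,
      Set.indicator {α : ι →₀ ℕ | α.support ⊆ S} (fun α => ∏ i ∈ α.support, g i (α i)) α := by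
    intro S
    rw [← (tsum_support_subset g hg hs S).2]
    exact tsum_subtype {α : ι →₀ ℕ | α.support ⊆ S} fun α => ∏ i ∈ α.support, g i (α i)
  rw [HasProd, SummationFilter.unconditional_filter]
  simp_rw [heq]
  refine tendsto_tsum_of_dominated_convergence hsum (fun α => ?_) (.of_forall fun S α => ?_)
  · refine tendsto_const_nhds.congr' ?_
    filter_upwards [eventually_ge_atTop α.support] with S hS
    have hmem : α ∈ {α : ι →₀ ℕ | α.support ⊆ S} := hS
    exact (Set.indicator_of_mem hmem fun α : ι →₀ ℕ => ∏ i ∈ α.support, g i (α i)).symm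
  · exact norm_indicator_le_norm_self _ _

lemma hasProd_inv_one_sub [CompleteSpace 𝕜] {w : ι → 𝕜} (hw : Summable fun i => ‖w i‖) (hc : c < 1)
    (hc0 : 0 ≤ c) (hwc : ∀ i, ‖w i‖ ≤ c) :
    HasProd (fun i => (1 - w i)⁻¹) (∑' α : ι →₀ ℕ, ∏ i ∈ α.support, w i ^ α i) := by
  have h := hasProd_tsum_of_bound (g := fun i a => w i ^ a) (fun i => pow_zero _) hw
    (fun _ => norm_nonneg _) hc0 hc fun i a => by
      rw [norm_pow, pow_succ']
      gcongr
      exact hwc i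
  simpa only [tsum_geometric_of_norm_lt_one ((hwc _).trans_lt hc)] using h

end EulerProduct

/-! ### The numerical zeta function of the affine line over a finite field -/

section MonicPolynomials

variable (K : Type) [Field K]

lemma prod_pow_natDegree {M : Type*} [CommMonoid M] (u : M) (α : MonicIrred K →₀ ℕ) :
    ∏ P ∈ α.support, (u ^ P.1.natDegree) ^ α P = u ^ factorizationDegree K α := by
  rw [factorizationDegree, Finsupp.sum, ← Finset.prod_pow_eq_pow_sum]
  refine Finset.prod_congr rfl fun P _ => ?_
  rw [← pow_mul, mul_comm]

variable {𝕜 : Type*} [NormedField 𝕜]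

/-- Grouping by degree, the `Q ^ n` monic polynomials of degree `n` contribute `(Q u) ^ n`, where
`Q` is the cardinality of `K`. -/
lemma hasSum_card_mul_pow [Finite K] [CompleteSpace 𝕜] {u : 𝕜}
    (h : Summable fun α : MonicIrred K →₀ ℕ => ‖u ^ factorizationDegree K α‖) :
    HasSum (fun n => ((Nat.card K : 𝕜) * u) ^ n)
      (∑' α : MonicIrred K →₀ ℕ, u ^ factorizationDegree K α) := by
  have h1 := (Equiv.sigmaFiberEquiv (factorizationDegree K)).hasSum_iff.mpr h.of_norm.hasSum
  refine h1.sigma fun n => ?_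
  have : Finite {α // factorizationDegree K α = n} :=
    .of_equiv _ (factorizationDegreeEquiv K n).symm
  have := Fintype.ofFinite {α // factorizationDegree K α = n}
  convert! hasSum_fintype _ using 1
  trans ∑ _a : {α // factorizationDegree K α = n}, u ^ n
  · rw [Finset.sum_const, Finset.card_univ, ← Nat.card_eq_fintype_card,
      natCard_factorizationDegree, nsmul_eq_mul, mul_pow, Nat.cast_pow]
  · refine Finset.sum_congr rfl fun α _ => ?_
    change u ^ n = u ^ factorizationDegree K α.1
    rw [α.2]

lemma summable_pow_factorizationDegree {u : 𝕜}
    (hP : Summable fun P : MonicIrred K => ‖u‖ ^ P.1.natDegree) (hu : ‖u‖ < 1) :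
    Summable fun α : MonicIrred K →₀ ℕ => ‖u ^ factorizationDegree K α‖ := by
  have h := summable_prod_of_bound (g := fun (P : MonicIrred K) a => (u ^ P.1.natDegree) ^ a)
    (fun i => pow_zero _) hP (fun _ => by positivity) (norm_nonneg u) hu fun P a => by
      rw [norm_pow, norm_pow, pow_succ']
      gcongr
      exact pow_le_of_le_one (norm_nonneg _) hu.le (MonicIrred.natDegree_ne_zero K P)
  simpa only [prod_pow_natDegree] using h

/-- The Euler product of the zeta function of the affine line over a finite field. -/
lemma hasProd_inv_one_sub_pow_natDegree [Finite K] [CompleteSpace 𝕜] {u : 𝕜}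
    (hP : Summable fun P : MonicIrred K => ‖u‖ ^ P.1.natDegree) (hu : ‖u‖ < 1)
    (hQ : ‖(Nat.card K : 𝕜) * u‖ < 1) :
    HasProd (fun P : MonicIrred K => (1 - u ^ P.1.natDegree)⁻¹) (1 - Nat.card K * u)⁻¹ := by
  have h := hasProd_inv_one_sub (w := fun P : MonicIrred K => u ^ P.1.natDegree)
    (by simpa only [norm_pow] using hP) hu (norm_nonneg u) fun P => by
      rw [norm_pow]
      exact pow_le_of_le_one (norm_nonneg _) hu.le (MonicIrred.natDegree_ne_zero K P)
  simp only [prod_pow_natDegree] at h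
  rwa [(hasSum_card_mul_pow K (summable_pow_factorizationDegree K hP hu)).unique
    (hasSum_geometric_of_norm_lt_one hQ)] at h

/-- The Dirichlet series of the affine line over a finite field does not converge at `1`. -/
lemma one_lt_of_summable_natDegree [Finite K] {σ : ℝ}
    (h : Summable fun P : MonicIrred K => ((Nat.card K ^ P.1.natDegree : ℕ) : ℝ) ^ (-σ)) :
    1 < σ := by
  by_contra! hσ
  have hQ : 1 < Nat.card K := Finite.one_lt_card
  have hQ' : (1 : ℝ) < Nat.card K := Nat.one_lt_cast.mpr hQ
  -- If `σ ≤ 1`, convergence at `σ` implies convergence at `1`, that is, at `u = Q⁻¹`. The sum over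
  -- monic polynomials would then converge too, although every degree contributes `Q ^ n * u ^ n =
  -- 1`.
  have hP : Summable fun P : MonicIrred K => ‖(Nat.card K : ℝ)⁻¹‖ ^ P.1.natDegree := by
    refine h.of_nonneg_of_le (fun _ => by positivity) fun P => ?_
    rw [Real.norm_of_nonneg (by positivity), inv_pow, Nat.cast_pow, ← Real.rpow_neg_one]
    exact Real.rpow_le_rpow_of_exponent_le (one_le_pow₀ hQ'.le) (by linarith)
  have hu : ‖(Nat.card K : ℝ)⁻¹‖ < 1 := by
    rw [Real.norm_of_nonneg (by positivity)]
    exact inv_lt_one_of_one_lt₀ hQ'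
  have hs := (hasSum_card_mul_pow K (summable_pow_factorizationDegree K hP hu)).summable
  rw [mul_inv_cancel₀ (by positivity)] at hs
  simp [summable_const_iff] at hs

end MonicPolynomials

lemma natCast_pow_cpow (n d : ℕ) (t : ℂ) : ((n ^ d : ℕ) : ℂ) ^ t = ((n : ℂ) ^ t) ^ d := by
  induction d with
  | zero => simp
  | succ d ih => rw [pow_succ, Nat.cast_mul, Complex.natCast_mul_natCast_cpow, ih, pow_succ]

/-! ### Consequences of absolute convergence -/

section Convergence

variable {X : Scheme.{0}}

/-- The zeta function of an arithmetic scheme converges absolutely on a half-plane. -/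
lemma exists_summable_pointNorm_rpow (f : X ⟶ Spec (.of ℤ)) [LocallyOfFiniteType f]
    [QuasiCompact f] :
    ∃ σ : ℝ, ∀ r : ℝ, σ < r → Summable fun x : closedPoints X => (pointNorm X x : ℝ) ^ (-r) := by
  obtain ⟨C, m, h⟩ := exists_card_pointNorm_le f
  -- At most `C n ^ m` points have norm `n`, so the series is dominated by `C ∑ n ^ (m - r)`.
  refine ⟨m + 1, fun r hr => ?_⟩
  rw [← (Equiv.sigmaFiberEquiv (pointNorm X)).summable_iff]
  have hfin : ∀ n, Finite {x // pointNorm X x = n} := by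
    intro n
    rcases eq_or_ne n 0 with rfl | hn
    · have : IsEmpty {x // pointNorm X x = 0} :=
        ⟨fun x => by have := one_lt_pointNorm f x.1; lia⟩
      infer_instance
    · exact (h n hn).1
  have hval : ∀ (n : ℕ) (x : {x // pointNorm X x = n}),
      (pointNorm X (Equiv.sigmaFiberEquiv (pointNorm X) ⟨n, x⟩) : ℝ) ^ (-r) = (n : ℝ) ^ (-r) :=
    fun n x => by rw [Equiv.sigmaFiberEquiv_apply, x.2]
  refine (summable_sigma_of_nonneg fun _ => Real.rpow_nonneg (Nat.cast_nonneg _) _).mpr ?_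
  refine ⟨fun n => have := hfin n; Summable.of_finite, ?_⟩
  have hs : Summable fun n : ℕ => (C : ℝ) * (n : ℝ) ^ ((m : ℝ) - r) :=
    (Real.summable_nat_rpow.mpr (by linarith)).mul_left _
  refine hs.of_nonneg_of_le (fun n => tsum_nonneg fun _ => Real.rpow_nonneg (Nat.cast_nonneg _) _)
    fun n => ?_
  simp only [hval]
  rw [tsum_const, nsmul_eq_mul]
  rcases eq_or_ne n 0 with rfl | hn
  · have : IsEmpty {x // pointNorm X x = 0} :=
      ⟨fun x => by have := one_lt_pointNorm f x.1; lia⟩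
    rw [Nat.card_of_isEmpty, Nat.cast_zero, zero_mul]
    exact mul_nonneg (Nat.cast_nonneg _) (Real.rpow_nonneg le_rfl _)
  · have hn' : (0 : ℝ) < n := Nat.cast_pos.mpr (Nat.pos_of_ne_zero hn)
    have hC : (Nat.card {x // pointNorm X x = n} : ℝ) ≤ C * (n : ℝ) ^ m := by
      exact_mod_cast (h n hn).2
    rw [sub_eq_add_neg, Real.rpow_add hn', Real.rpow_natCast, ← mul_assoc]
    gcongr

variable (f : X ⟶ Spec (.of ℤ)) [LocallyOfFiniteType f] {σ : ℝ}

/-- A rational point of the affine line over a field. -/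
def linearMonicIrred {K : Type} [Field K] (a : K) : MonicIrred K :=
  ⟨Polynomial.X - Polynomial.C a, Polynomial.monic_X_sub_C a, Polynomial.irreducible_X_sub_C a⟩

lemma linearMonicIrred_injective {K : Type} [Field K] :
    Function.Injective (linearMonicIrred : K → MonicIrred K) := by
  intro a b h
  have h' : Polynomial.X - Polynomial.C a = Polynomial.X - Polynomial.C b := congrArg Subtype.val h
  exact Polynomial.C_injective (sub_right_injective h')

lemma summable_sigma_monicIrred [JacobsonSpace X]
    (h : Summable fun y : closedPoints (affineLine X) =>
      (pointNorm (affineLine X) y : ℝ) ^ (-σ)) :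
    Summable fun q : Σ x : closedPoints X, MonicIrred (X.residueField x.1) =>
      ((pointNorm X q.1 ^ q.2.1.natDegree : ℕ) : ℝ) ^ (-σ) := by
  rw [← (sigmaMonicIrredEquiv X).summable_iff] at h
  refine h.congr fun q => ?_
  rw [Function.comp_apply, pointNorm_sigmaMonicIrredEquiv]

include f in
-- The line over `x` has `N(x)` rational points, each of norm `N(x)`; together they contribute `N(x)
-- · N(x)^(-σ)` to the convergent series.
lemma summable_pointNorm_rpow_one_sub
    (h : Summable fun y : closedPoints (affineLine X) =>
      (pointNorm (affineLine X) y : ℝ) ^ (-σ)) :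
    Summable fun x : closedPoints X => (pointNorm X x : ℝ) ^ (1 - σ) := by
  have := jacobsonSpace_of_arithmetic f
  have hinj : Function.Injective fun q : Σ x : closedPoints X, X.residueField x.1 =>
      (⟨q.1, linearMonicIrred q.2⟩ : Σ x : closedPoints X, MonicIrred (X.residueField x.1)) := by
    rintro ⟨x, a⟩ ⟨y, b⟩ h
    obtain ⟨rfl, h'⟩ := Sigma.mk.inj h
    have hab : a = b := linearMonicIrred_injective (eq_of_heq h')
    rw [hab]
  have h1 := ((summable_sigma_monicIrred h).comp_injective hinj).sigma
  refine h1.congr fun x => ?_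
  have hx := one_lt_pointNorm f x
  simp only [Function.comp_apply, linearMonicIrred, Polynomial.natDegree_X_sub_C,
    pow_one]
  rw [tsum_const, nsmul_eq_mul, sub_eq_add_neg,
    Real.rpow_add (Nat.cast_pos.mpr (zero_lt_one.trans hx)), Real.rpow_one]
  rfl

include f in
lemma one_lt_of_summable (x : closedPoints X)
    (h : Summable fun y : closedPoints (affineLine X) =>
      (pointNorm (affineLine X) y : ℝ) ^ (-σ)) : 1 < σ := by
  have := jacobsonSpace_of_arithmetic f
  have := finite_residueField_int f x
  exact one_lt_of_summable_natDegree (X.residueField x.1)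
    ((summable_sigma_monicIrred h).sigma_factor x)

include f in
-- Norms are at least `2` and `σ > 1`, so `2 ^ (1 - σ)` works. The inequality `σ > 1` needs a closed
-- point, hence the separate empty case.
lemma exists_pointNorm_rpow_le
    (h : Summable fun y : closedPoints (affineLine X) =>
      (pointNorm (affineLine X) y : ℝ) ^ (-σ)) :
    ∃ c : ℝ, 0 ≤ c ∧ c < 1 ∧ ∀ x : closedPoints X, (pointNorm X x : ℝ) ^ (1 - σ) ≤ c := by
  cases isEmpty_or_nonempty (closedPoints X) with
  | inl he => exact ⟨0, le_rfl, zero_lt_one, fun x => he.elim x⟩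
  | inr hne =>
    have hσ := one_lt_of_summable f hne.some h
    refine ⟨2 ^ (1 - σ), by positivity, Real.rpow_lt_one_of_one_lt_of_neg one_lt_two (by linarith),
      fun x => Real.rpow_le_rpow_of_nonpos two_pos ?_ (by linarith)⟩
    exact_mod_cast one_lt_pointNorm f x

end Convergence

/-! ### Euler factors at complex arguments -/

section LocalFactor

variable {ι : Type*} {N w : ι → ℂ} {c : ℝ}

/-- The coefficients of the Euler factor of `Ψ` at a closed point. -/
def psiCoeff (N w : ℂ) (a : ℕ) : ℂ := if a = 0 then 1 else (N * w) ^ a * (1 + N⁻¹)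

lemma norm_psiCoeff_le {N w : ℂ} (hN : 1 ≤ ‖N‖) (hc : ‖N * w‖ ≤ c) (a : ℕ) :
    ‖psiCoeff N w (a + 1)‖ ≤ 2 * ‖N * w‖ * c ^ a := by
  rw [psiCoeff, if_neg a.succ_ne_zero, norm_mul, norm_pow, pow_succ']
  have h1 : ‖1 + N⁻¹‖ ≤ 2 := by
    refine (norm_add_le _ _).trans ?_
    rw [norm_one, norm_inv]
    linarith [inv_le_one_of_one_le₀ hN]
  calc _ ≤ ‖N * w‖ * c ^ a * 2 := by
        have := (norm_nonneg _).trans hc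
        gcongr
    _ = _ := by ring

lemma tsum_psiCoeff {N w : ℂ} (hN : N ≠ 0) (hw : ‖N * w‖ < 1) :
    ∑' a, psiCoeff N w a = (1 + w) * (1 - N * w)⁻¹ := by
  have hgeo := summable_geometric_of_norm_lt_one hw
  have hne : 1 - N * w ≠ 0 := by
    intro h
    rw [← sub_eq_zero.mp h, norm_one] at hw
    exact lt_irrefl _ hw
  have h1 : ∀ a, psiCoeff N w (a + 1) = (N * w) ^ a * ((N * w) * (1 + N⁻¹)) := fun a => by
    rw [psiCoeff, if_neg a.succ_ne_zero, pow_succ]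
    ring
  rw [((summable_nat_add_iff 1).mp (by
    simp only [h1]; exact hgeo.mul_right _)).tsum_eq_zero_add]
  simp only [h1]
  rw [tsum_mul_right, tsum_geometric_of_norm_lt_one hw, psiCoeff, if_pos rfl]
  field_simp
  ring

/-- The analytic form of the local identity. -/
lemma hasProd_psi_mul {Ψ Z Z₁ Z₂ : ℂ}
    (hN : ∀ i, 1 ≤ ‖N i‖) (hNw : ∀ i, ‖N i * w i‖ < 1)
    (hΨ : HasProd (fun i => ∑' a, psiCoeff (N i) (w i) a) Ψ)
    (hZ : HasProd (fun i => (1 - w i)⁻¹) Z) (hZ₁ : HasProd (fun i => (1 - N i * w i)⁻¹) Z₁)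
    (hZ₂ : HasProd (fun i => (1 - w i ^ 2)⁻¹) Z₂) : Ψ * Z₂ = Z * Z₁ := by
  refine (hΨ.mul hZ₂).unique ?_
  convert! hZ.mul hZ₁ using 2 with i
  have hw : ‖w i‖ < 1 := by
    refine lt_of_le_of_lt ?_ (hNw i)
    rw [norm_mul]
    exact le_mul_of_one_le_left (norm_nonneg _) (hN i)
  have h1 : 1 - w i ≠ 0 := by
    intro h
    rw [← sub_eq_zero.mp h, norm_one] at hw
    exact lt_irrefl _ hw
  have h2 : 1 + w i ≠ 0 := by
    intro h
    rw [← neg_eq_iff_add_eq_zero.mpr h, norm_neg, norm_one] at hw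
    exact lt_irrefl _ hw
  rw [tsum_psiCoeff (norm_pos_iff.mp (zero_lt_one.trans_le (hN i))) (hNw i),
    show 1 - w i ^ 2 = (1 - w i) * (1 + w i) by ring]
  field_simp

/-- The product of the `1 - w i` converges as well, and its value times `Z` is `1`. -/
lemma ne_zero_of_hasProd_inv_one_sub {Z : ℂ} (hw : Summable fun i => ‖w i‖)
    (hw1 : ∀ i, ‖w i‖ < 1) (hZ : HasProd (fun i => (1 - w i)⁻¹) Z) : Z ≠ 0 := by
  have h : Multipliable fun i => 1 + -w i := multipliable_one_add_of_summable (by simpa using hw)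
  have h1 := (h.hasProd.mul hZ).unique (a₂ := 1) (by
    convert! hasProd_one (α := ℂ) (β := ι) with i
    rw [← sub_eq_add_neg]
    refine mul_inv_cancel₀ fun h => ?_
    have := hw1 i
    rw [← sub_eq_zero.mp h, norm_one] at this
    exact lt_irrefl _ this)
  exact right_ne_zero_of_mul_eq_one h1

end LocalFactor

/-! ### The identity of functions -/

section Analytic

variable {X : Scheme.{0}} (f : X ⟶ Spec (.of ℤ)) [LocallyOfFiniteType f]

include f in
lemma norm_pointNorm_mul_cpow (x : closedPoints X) (s : ℂ) :
    ‖(pointNorm X x : ℂ) * (pointNorm X x : ℂ) ^ (-s)‖ = (pointNorm X x : ℝ) ^ (1 - s.re) := by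
  have hx : 0 < pointNorm X x := zero_lt_one.trans (one_lt_pointNorm f x)
  rw [norm_mul, Complex.norm_natCast_cpow_of_pos hx, Complex.norm_natCast, Complex.neg_re,
    sub_eq_add_neg, Real.rpow_add (Nat.cast_pos.mpr hx), Real.rpow_one]

include f in
lemma norm_pointNorm_cpow_le (x : closedPoints X) (s : ℂ) :
    ‖(pointNorm X x : ℂ) ^ (-s)‖ ≤ (pointNorm X x : ℝ) ^ (1 - s.re) := by
  rw [← norm_pointNorm_mul_cpow f, norm_mul, Complex.norm_natCast]
  exact le_mul_of_one_le_left (norm_nonneg _) (Nat.one_le_cast.mpr (one_lt_pointNorm f x).le)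

/-- Expressing the terms of `Ψ(X_p, p^(-s))` through norms of points of `X` lets one bound over `X`
control all fibres. -/
lemma psi_mul_pow (p : Nat.Primes) (α : EffZeroCycle (primeFibre f p)) (s : ℂ) :
    (psi (primeFibreMap f p) α : ℂ) * ((p : ℂ) ^ (-s)) ^ cycleDegree (primeFibreMap f p) α =
      ∏ z ∈ α.support, psiCoeff (pointNorm X (sigmaPrimeFibreEquiv f ⟨p, z⟩))
        ((pointNorm X (sigmaPrimeFibreEquiv f ⟨p, z⟩) : ℂ) ^ (-s)) (α z) := by
  rw [psi_eq_prod, cycleDegree, Finsupp.sum, ← Finset.prod_pow_eq_pow_sum, Nat.card_zmod,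
    Rat.cast_prod, ← Finset.prod_mul_distrib]
  refine Finset.prod_congr rfl fun z hz => ?_
  have hz' : α z ≠ 0 := Finsupp.mem_support_iff.mp hz
  rw [if_neg hz', psiCoeff, if_neg hz', pointNorm_sigmaPrimeFibreEquiv, natCast_pow_cpow,
    mul_comm (α z), pow_mul]
  push_cast
  ring

variable {s : ℂ}
  (h : Summable fun y : closedPoints (affineLine X) =>
    (pointNorm (affineLine X) y : ℝ) ^ (-s.re))

include h in
-- The common value `Ψ` links the product over closed points, where the Euler factors are compared,
-- to the product over primes, obtained from it by grouping points by residue characteristic.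
lemma psi_analytic :
    (∀ p : Nat.Primes, Summable fun α : EffZeroCycle (primeFibre f p) =>
      (psi (primeFibreMap f p) α : ℂ) *
        ((p : ℂ) ^ (-s)) ^ cycleDegree (primeFibreMap f p) α) ∧
    ∃ Ψ, HasProd (fun x : closedPoints X =>
        ∑' a, psiCoeff (pointNorm X x) ((pointNorm X x : ℂ) ^ (-s)) a) Ψ ∧
      HasProd (fun p => psiValue (primeFibreMap f p) ((p : ℂ) ^ (-s))) Ψ := by
  obtain ⟨c, hc0, hc1, hc⟩ := exists_pointNorm_rpow_le f h
  have hu := (summable_pointNorm_rpow_one_sub f h).mul_left 2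
  have hb : ∀ (x : closedPoints X) a,
      ‖psiCoeff (pointNorm X x) ((pointNorm X x : ℂ) ^ (-s)) (a + 1)‖ ≤
        2 * (pointNorm X x : ℝ) ^ (1 - s.re) * c ^ a := by
    intro x a
    rw [← norm_pointNorm_mul_cpow f]
    refine norm_psiCoeff_le ?_ ((norm_pointNorm_mul_cpow f x s).trans_le (hc x)) a
    rw [Complex.norm_natCast]
    exact Nat.one_le_cast.mpr (one_lt_pointNorm f x).le
  have hu0 : ∀ x : closedPoints X, 0 ≤ 2 * (pointNorm X x : ℝ) ^ (1 - s.re) :=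
    fun x => by positivity
  have hinj : ∀ p, Function.Injective fun z => sigmaPrimeFibreEquiv f ⟨p, z⟩ :=
    fun p => (sigmaPrimeFibreEquiv f).injective.comp sigma_mk_injective
  refine ⟨fun p => ?_, _, hasProd_tsum_of_bound (fun _ => if_pos rfl) hu hu0 hc0 hc1 hb, ?_⟩
  · simp_rw [psi_mul_pow]
    exact (summable_prod_of_bound
      (g := fun z => psiCoeff (pointNorm X (sigmaPrimeFibreEquiv f ⟨p, z⟩))
        ((pointNorm X (sigmaPrimeFibreEquiv f ⟨p, z⟩) : ℂ) ^ (-s)))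
      (fun _ => if_pos rfl) (hu.comp_injective (hinj p)) (fun _ => hu0 _) hc0 hc1
      fun z => hb _).of_norm
  · have hX := hasProd_tsum_of_bound
      (g := fun x : closedPoints X => psiCoeff (pointNorm X x) ((pointNorm X x : ℂ) ^ (-s)))
      (fun _ => if_pos rfl) hu hu0 hc0 hc1 hb
    rw [← (sigmaPrimeFibreEquiv f).hasProd_iff] at hX
    refine hX.sigma fun p => ?_
    rw [psiValue]
    simp_rw [psi_mul_pow]
    exact hasProd_tsum_of_bound
      (g := fun z => psiCoeff (pointNorm X (sigmaPrimeFibreEquiv f ⟨p, z⟩))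
        ((pointNorm X (sigmaPrimeFibreEquiv f ⟨p, z⟩) : ℂ) ^ (-s)))
      (fun _ => if_pos rfl) (hu.comp_injective (hinj p)) (fun _ => hu0 _) hc0 hc1
      fun z => hb _

include f h in
lemma zeta_affineLine_analytic :
    ∃ Z₁, HasProd (fun y : closedPoints (affineLine X) =>
        (1 - (pointNorm (affineLine X) y : ℂ) ^ (-s))⁻¹) Z₁ ∧
      HasProd (fun x : closedPoints X =>
        (1 - (pointNorm X x : ℂ) * (pointNorm X x : ℂ) ^ (-s))⁻¹) Z₁ := by
  have hJ := jacobsonSpace_of_arithmetic f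
  obtain ⟨c, hc0, hc1, hc⟩ := exists_pointNorm_rpow_le f h
  have hnorm : ∀ y : closedPoints (affineLine X), ‖(pointNorm (affineLine X) y : ℂ) ^ (-s)‖ =
      (pointNorm (affineLine X) y : ℝ) ^ (-s.re) := fun y => by
    rw [Complex.norm_natCast_cpow_of_pos (zero_lt_one.trans
      (one_lt_pointNorm ((affineLine X ↘ X) ≫ f) y)), Complex.neg_re]
  have hle : ∀ x : closedPoints X, ‖(pointNorm X x : ℂ) ^ (-s)‖ ≤ c := fun x =>
    (norm_pointNorm_cpow_le f x s).trans (hc x)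
  have hy : ∀ (x : closedPoints X) (P : MonicIrred (X.residueField x.1)),
      (pointNorm (affineLine X) (sigmaMonicIrredEquiv X ⟨x, P⟩) : ℂ) ^ (-s) =
        ((pointNorm X x : ℂ) ^ (-s)) ^ P.1.natDegree := fun x P => by
    rw [pointNorm_sigmaMonicIrredEquiv, natCast_pow_cpow]
  have hA := hasProd_inv_one_sub (w := fun y : closedPoints (affineLine X) =>
    (pointNorm (affineLine X) y : ℂ) ^ (-s)) (by simpa only [hnorm] using h) hc1 hc0 fun y => by
      obtain ⟨⟨x, P⟩, rfl⟩ := (sigmaMonicIrredEquiv X).surjective y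
      rw [hy, norm_pow]
      exact (pow_le_of_le_one (norm_nonneg _) ((hle x).trans hc1.le)
        (MonicIrred.natDegree_ne_zero _ P)).trans (hle x)
  refine ⟨_, hA, ?_⟩
  have hA' := (sigmaMonicIrredEquiv X).hasProd_iff.mpr hA
  -- Regrouping over `x`, the inner product is the zeta function of the affine line over `κ(x)` at
  -- `u = N(x)^(-s)`.
  refine hA'.sigma fun x => ?_
  have := finite_residueField_int f x
  have hP : Summable fun P : MonicIrred (X.residueField x.1) =>
      ‖(pointNorm X x : ℂ) ^ (-s)‖ ^ P.1.natDegree := by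
    refine (((sigmaMonicIrredEquiv X).summable_iff.mpr h).sigma_factor x).congr fun P => ?_
    rw [Function.comp_apply, ← hnorm, hy, norm_pow]
  have hfib := hasProd_inv_one_sub_pow_natDegree (X.residueField x.1) hP
    ((hle x).trans_lt hc1) ((norm_pointNorm_mul_cpow f x s).trans_lt ((hc x).trans_lt hc1))
  simp only [Function.comp_apply, hy]
  exact hfib

include f h in
lemma zeta_analytic :
    Multipliable (fun x : closedPoints X => (1 - (pointNorm X x : ℂ) ^ (-s))⁻¹) ∧
    Multipliable (fun x : closedPoints X => (1 - (pointNorm X x : ℂ) ^ (-(2 * s)))⁻¹) ∧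
    zeta X (2 * s) ≠ 0 := by
  obtain ⟨c, hc0, hc1, hc⟩ := exists_pointNorm_rpow_le f h
  have hu := summable_pointNorm_rpow_one_sub f h
  have hle : ∀ x : closedPoints X, ‖(pointNorm X x : ℂ) ^ (-s)‖ ≤ c := fun x =>
    (norm_pointNorm_cpow_le f x s).trans (hc x)
  have hsq : ∀ x : closedPoints X,
      ‖(pointNorm X x : ℂ) ^ (-(2 * s))‖ ≤ ‖(pointNorm X x : ℂ) ^ (-s)‖ := fun x => by
    rw [← mul_neg, Complex.cpow_ofNat_mul, norm_pow]
    exact pow_le_of_le_one (norm_nonneg _) ((hle x).trans hc1.le) two_ne_zero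
  have hs1 : Summable fun x : closedPoints X => ‖(pointNorm X x : ℂ) ^ (-s)‖ :=
    hu.of_nonneg_of_le (fun _ => norm_nonneg _) fun x => norm_pointNorm_cpow_le f x s
  have hs2 : Summable fun x : closedPoints X => ‖(pointNorm X x : ℂ) ^ (-(2 * s))‖ :=
    hs1.of_nonneg_of_le (fun _ => norm_nonneg _) hsq
  have h2 := (hasProd_inv_one_sub hs2 hc1 hc0 fun x => (hsq x).trans (hle x)).multipliable
  exact ⟨(hasProd_inv_one_sub hs1 hc1 hc0 hle).multipliable, h2,
    ne_zero_of_hasProd_inv_one_sub hs2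
      (fun x => ((hsq x).trans (hle x)).trans_lt hc1) h2.hasProd⟩

include h in
lemma globalPsi_eq :
    globalPsi f s = zeta X s * zeta (affineLine X) s / zeta X (2 * s) := by
  obtain ⟨c, hc0, hc1, hc⟩ := exists_pointNorm_rpow_le f h
  obtain ⟨-, Ψ, hΨ, hΨ'⟩ := psi_analytic f h
  obtain ⟨Z₁, hZ₁, hZ₁'⟩ := zeta_affineLine_analytic f h
  obtain ⟨hZ, hZ₂, hne⟩ := zeta_analytic f h
  rw [eq_div_iff hne, globalPsi, hΨ'.tprod_eq, zeta, zeta, zeta, hZ₁.tprod_eq]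
  refine hasProd_psi_mul (fun x => ?_) (fun x => ?_) hΨ hZ.hasProd hZ₁' ?_
  · rw [Complex.norm_natCast]
    exact Nat.one_le_cast.mpr (one_lt_pointNorm f x).le
  · exact (norm_pointNorm_mul_cpow f x s).trans_lt ((hc x).trans_lt hc1)
  · simpa only [← mul_neg, Complex.cpow_ofNat_mul] using hZ₂.hasProd

end Analytic

end ArithPsi
end

theorem mainTheorem12 :
    -- The statement over a finite field, as an identity of formal power series.
    (∀ (k : Type) [Field k] [Finite k] (X : Scheme.{0}) (f : X ⟶ Spec (.of k))
      [LocallyOfFiniteType f] [QuasiCompact f],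
      (∀ n : ℕ, {α : ArithPsi.EffZeroCycle X | ArithPsi.cycleDegree f α = n}.Finite) ∧
      (∀ n : ℕ, ∀ᶠ S : Finset (closedPoints X) in atTop,
        PowerSeries.coeff n (∏ x ∈ S, ArithPsi.hasseWeilFactor f x) =
          PowerSeries.coeff n (ArithPsi.hasseWeilZeta f)) ∧
      PowerSeries.constantCoeff (ArithPsi.hasseWeilZeta f) = 1 ∧
      ArithPsi.psiSeries f =
        ArithPsi.hasseWeilZeta f *
          PowerSeries.rescale (Nat.card k : ℚ) (ArithPsi.hasseWeilZeta f) *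
          (PowerSeries.expand 2 two_ne_zero (ArithPsi.hasseWeilZeta f))⁻¹) ∧
    -- The statement for arithmetic schemes.
    (∀ (X : Scheme.{0}) (f : X ⟶ Spec (.of ℤ)) [LocallyOfFiniteType f] [QuasiCompact f],
      -- As an identity of formal Dirichlet series.
      ((∀ n : ℕ, ∀ᶠ S : Finset Nat.Primes in atTop,
          (∏ p ∈ S, ArithPsi.psiFactor f p) n = ArithPsi.formalPsi f n) ∧
        (∀ n : ℕ, ∀ᶠ S : Finset (closedPoints X) in atTop,
          (∏ x ∈ S, ArithPsi.zetaFactor X x) n = ArithPsi.formalZeta X n) ∧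
        (∀ n : ℕ, ∀ᶠ S : Finset (closedPoints (ArithPsi.affineLine X)) in atTop,
          (∏ x ∈ S, ArithPsi.zetaFactor (ArithPsi.affineLine X) x) n =
            ArithPsi.formalZeta (ArithPsi.affineLine X) n) ∧
        IsUnit (ArithPsi.atTwoS (ArithPsi.formalZeta X)) ∧
        ArithPsi.formalPsi f * ArithPsi.atTwoS (ArithPsi.formalZeta X) =
          ArithPsi.formalZeta X * ArithPsi.formalZeta (ArithPsi.affineLine X)) ∧
      -- As an identity of functions: the set of absolute convergence contains a half-plane.
      (∃ σ : ℝ, ∀ r : ℝ, σ < r → Summable fun y : closedPoints (ArithPsi.affineLine X) =>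
        (ArithPsi.pointNorm (ArithPsi.affineLine X) y : ℝ) ^ (-r)) ∧
      -- The identity holds wherever the zeta function of `X × 𝔸¹` converges absolutely.
      (∀ s : ℂ, (Summable fun y : closedPoints (ArithPsi.affineLine X) =>
          (ArithPsi.pointNorm (ArithPsi.affineLine X) y : ℝ) ^ (-s.re)) →
        (∀ p : Nat.Primes, Summable fun α : ArithPsi.EffZeroCycle (ArithPsi.primeFibre f p) =>
          (ArithPsi.psi (ArithPsi.primeFibreMap f p) α : ℂ) *
            ((p : ℂ) ^ (-s)) ^ ArithPsi.cycleDegree (ArithPsi.primeFibreMap f p) α) ∧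
        (Multipliable fun p : Nat.Primes =>
          ArithPsi.psiValue (ArithPsi.primeFibreMap f p) ((p : ℂ) ^ (-s))) ∧
        (Multipliable fun x : closedPoints X =>
          (1 - (ArithPsi.pointNorm X x : ℂ) ^ (-s))⁻¹) ∧
        (Multipliable fun x : closedPoints X =>
          (1 - (ArithPsi.pointNorm X x : ℂ) ^ (-(2 * s)))⁻¹) ∧
        (Multipliable fun y : closedPoints (ArithPsi.affineLine X) =>
          (1 - (ArithPsi.pointNorm (ArithPsi.affineLine X) y : ℂ) ^ (-s))⁻¹) ∧
        ArithPsi.zeta X (2 * s) ≠ 0 ∧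
        ArithPsi.globalPsi f s =
          ArithPsi.zeta X s * ArithPsi.zeta (ArithPsi.affineLine X) s /
            ArithPsi.zeta X (2 * s))) := by
  refine ⟨fun k _ _ X f _ _ => ?_, fun X f _ _ => ⟨?_, ?_, fun s h => ?_⟩⟩
  · exact ⟨ArithPsi.finite_setOf_cycleDegree_eq f,
      ArithPsi.eventually_coeff_prod_hasseWeilFactor f, ArithPsi.constantCoeff_hasseWeilZeta f,
      ArithPsi.psiSeries_eq f⟩
  · exact ⟨ArithPsi.eventually_prod_psiFactor f, ArithPsi.eventually_prod_zetaFactor f,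
      ArithPsi.eventually_prod_zetaFactor ((ArithPsi.affineLine X ↘ X) ≫ f),
      ArithPsi.isUnit_atTwoS_formalZeta f, ArithPsi.formalPsi_mul_atTwoS f⟩
  · exact ArithPsi.exists_summable_pointNorm_rpow ((ArithPsi.affineLine X ↘ X) ≫ f)
  · obtain ⟨hsum, Ψ, -, hΨ⟩ := ArithPsi.psi_analytic f h
    obtain ⟨Z₁, hZ₁, -⟩ := ArithPsi.zeta_affineLine_analytic f h
    obtain ⟨hZ, hZ₂, hne⟩ := ArithPsi.zeta_analytic f h
    exact ⟨hsum, hΨ.multipliable, hZ, hZ₂, hZ₁.multipliable, hne, ArithPsi.globalPsi_eq f h⟩
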